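/- **Setting.** Let $\mathbb{R}_+^{\mathbb{Z}}$ be the space of two-sided sequences of nonnegative reals with the metric $d(\mathbf{x},\mathbf{y})=\sum_{i\in\mathbb{Z}}(|x_i-y_i|\wedge 1)/2^{|i|+1}$, let $\mathbf{0}$ be its zero sequence and $\mathbf{e}_i$ the sequence with $i$-th component $1$ and all others $0$. Let $\mathbb{M}(\mathbb{R}_+^{\mathbb{Z}}\setminus\{\mathbf{0}\})$ be the set of Borel measures on $\mathbb{R}_+^{\mathbb{Z}}\setminus\{\mathbf{0}\}$ that are finite on $\{\mathbf{x}: d(\mathbf{x},\mathbf{0})\ge r\}$ for every $r>0$, with the topology in which basic neighbourhoods of $\mu$ are the sets $\{\nu: |\int f_i\,d\nu-\int f_i\,d\mu|<\varepsilon,\ i=1,\dots,k\}$, where $\varepsilon>0$ and the $f_i$ are nonnegative bounded continuous functions on $\mathbb{R}_+^{\mathbb{Z}}\setminus\{\mathbf{0}\}$, each vanishing on $\{\mathbf{x}:d(\mathbf{x},\mathbf{0})<r\}$ for some $r>0$. For $\alpha>0$ let $\nu_\alpha$ be the measure on $(0,\infty)$ with $\nu_\alpha(x,\infty)=x^{-\alpha}$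 for $x>0$. **Theorem.** Let $\alpha>0$ and let $(Z_i)_{i\in\mathbb{Z}}$ be i.i.d. nonnegative random variables with $$\lim_{t\to\infty}\frac{P[Z_0>tz]}{P[Z_0>t]}=z^{-\alpha}\qquad\text{for all } z>0.$$ Let $(\psi_j)_{j\ge 0}$ be nonnegative constants with $\psi_0>0$ and $\sum_{j\ge0}\psi_j^{\delta}<\infty$ for some $\delta$ with $0<\delta<\alpha\wedge 1$. For $\mathbf{z}\in\mathbb{R}_+^{\mathbb{Z}}$ put $\mathbf{T}^\infty(\mathbf{z})=\big(\sum_{j\ge 0}\psi_j z_{k-j}\big)_{k\in\mathbb{Z}}$ wherever these series converge. Then: 1. Almost surely, the series $X_k=\sum_{j\ge 0}\psi_jZ_{k-j}$ converges for every $k\in\mathbb{Z}$. Put $\mathbf{X}=(X_k)_{k\in\mathbb{Z}}=\mathbf{T}^\infty(\mathbf{Z})$. 2. The measure $$\nu^{(0)}(\cdot)=\sum_{i=-\infty}^{\infty}\int \mathbf{1}\{\mathbf{T}^\infty(z\,\mathbf{e}_i)\in\cdot\}\,\nu_\alpha(dz)$$ belongs to $\mathbb{M}(\mathbb{R}_+^{\mathbb{Z}}\setminus\{\mathbf{0}\})$.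 3. For every function $b\ge 0$ such that $\lim_{t\to\infty}tP[Z_0>b(t)z]=z^{-\alpha}$ for all $z>0$, $$tP[\mathbf{X}/b(t)\in\cdot]\to\nu^{(0)}\quad\text{in }\mathbb{M}(\mathbb{R}_+^{\mathbb{Z}}\setminus\{\mathbf{0}\})\text{ as }t\to\infty.$$ 4. $\mathbf{X}$ is regularly varying on $\mathbb{R}_+^{\mathbb{Z}}\setminus\{\mathbf{0}\}$ with limit measure $\nu^{(0)}$: the measure $\nu^{(0)}$ is nonzero, and there is a positive nondecreasing function $b$ as in 3, so that the convergence in 3 holds along it. -/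

import Mathlib

open MeasureTheory ProbabilityTheory Filter Topology Set
open scoped NNReal ENNReal

noncomputable section

/-! ### Measures on a metric space with a closed set removed -/

section MO

variable {S : Type*} [PseudoMetricSpace S] [MeasurableSpace S]

/-- `MOMeasure C` is the class `𝕄(S ∖ C)` of Borel measures on `O = S ∖ C` that are finite on
`S ∖ C^r` for every `r > 0`, where `C^r = {x | d(x, C) < r}` (which is `Metric.thickening r C`). -/
def MOMeasure (C : Set S) : Type _ :=
  {μ : Measure ↥(Cᶜ) // ∀ r : ℝ, 0 < r → μ {x | (x : S) ∉ Metric.thickening r C} < ∞}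

/-- The underlying measure on `S ∖ C`. -/
def MOMeasure.toMeasure {C : Set S} (μ : MOMeasure C) : Measure ↥(Cᶜ) := μ.1

/-- The test functions: nonnegative bounded continuous functions on `S ∖ C` that vanish on
`C^r` for some `r > 0`. -/
structure MOTestFun (C : Set S) where
  toFun : ↥(Cᶜ) → ℝ≥0
  continuous_toFun : Continuous toFun
  bounded_toFun : ∃ K : ℝ≥0, ∀ x, toFun x ≤ K
  vanishes_near : ∃ r : ℝ, 0 < r ∧ ∀ x : ↥(Cᶜ), (x : S) ∈ Metric.thickening r C → toFun x = 0

/-- The topology whose basic neighbourhoods of `μ` are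
`{ν | |∫ f_i dν - ∫ f_i dμ| < ε, i = 1, …, k}`, with `f_i` test functions. All the integrals
are finite, so that they may be taken in `ℝ≥0∞`. -/
instance (C : Set S) : TopologicalSpace (MOMeasure C) :=
  ⨅ f : MOTestFun C,
    TopologicalSpace.induced (fun μ => ∫⁻ x, (f.toFun x : ℝ≥0∞) ∂μ.toMeasure) inferInstance

/-- The restriction to `S ∖ C` of a finite measure on `S`, as an element of `𝕄(S ∖ C)`
(for closed `C`, as everywhere here). -/
def MOMeasure.ofFinite (C : Set S) (μ : Measure S) [IsFiniteMeasure μ] : MOMeasure C :=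
  ⟨μ.comap Subtype.val, fun _ _ => by
    refine lt_of_le_of_lt (measure_mono (subset_univ _)) ?_
    refine lt_of_le_of_lt (Measure.comap_apply_le _ _ ?_) (measure_lt_top μ (Subtype.val '' univ))
    exact MeasurableSet.univ.nullMeasurableSet⟩

end MO

/-! ### The space of two-sided nonnegative sequences -/

/-- Two-sided sequences of nonnegative real numbers. -/
def RZ : Type := ℤ → ℝ≥0

namespace RZ

instance : TopologicalSpace RZ := inferInstanceAs (TopologicalSpace (ℤ → ℝ≥0))
instance : MeasurableSpace RZ := inferInstanceAs (MeasurableSpace (ℤ → ℝ≥0))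
instance : BorelSpace RZ := inferInstanceAs (BorelSpace (ℤ → ℝ≥0))
instance : Zero RZ := inferInstanceAs (Zero (ℤ → ℝ≥0))
instance : SMul ℝ≥0 RZ := inferInstanceAs (SMul ℝ≥0 (ℤ → ℝ≥0))

/-- The metric `d(x, y) = ∑_{i ∈ ℤ} (|x_i - y_i| ∧ 1) / 2^(|i| + 1)`. -/
def dZ (x y : RZ) : ℝ := ∑' i : ℤ, min |(x i : ℝ) - (y i : ℝ)| 1 / 2 ^ (i.natAbs + 1)

theorem summable_weight : Summable fun i : ℤ => (1 : ℝ) / 2 ^ (i.natAbs + 1) := by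
  have h : Summable fun n : ℕ => (1 : ℝ) / 2 ^ (n + 1) := by
    have := (summable_geometric_two).mul_right (1 / 2 : ℝ)
    refine this.congr fun n => ?_
    rw [pow_succ, one_div_pow]; field_simp
  exact Summable.of_nat_of_neg (by simpa using h) (by simpa using h)

theorem term_nonneg (x y : RZ) (i : ℤ) :
    0 ≤ min |(x i : ℝ) - (y i : ℝ)| 1 / 2 ^ (i.natAbs + 1) := by positivity

theorem term_le (x y : RZ) (i : ℤ) :
    min |(x i : ℝ) - (y i : ℝ)| 1 / 2 ^ (i.natAbs + 1) ≤ 1 / 2 ^ (i.natAbs + 1) := by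
  gcongr; exact min_le_right _ _

theorem summable_term (x y : RZ) :
    Summable fun i : ℤ => min |(x i : ℝ) - (y i : ℝ)| 1 / 2 ^ (i.natAbs + 1) :=
  Summable.of_nonneg_of_le (term_nonneg x y) (term_le x y) summable_weight

theorem dZ_self (x : RZ) : dZ x x = 0 := by simp [dZ]

theorem dZ_comm (x y : RZ) : dZ x y = dZ y x := by
  simp only [dZ, abs_sub_comm]

theorem dZ_triangle (x y z : RZ) : dZ x z ≤ dZ x y + dZ y z := by
  unfold dZ
  rw [← (summable_term x y).tsum_add (summable_term y z)]
  refine (summable_term x z).tsum_le_tsum (fun i => ?_)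
    ((summable_term x y).add (summable_term y z))
  rw [← add_div]
  gcongr
  have h := abs_sub_le (x i : ℝ) (y i) (z i)
  have h1 := abs_nonneg ((x i : ℝ) - y i)
  have h2 := abs_nonneg ((y i : ℝ) - z i)
  rcases min_cases |(x i : ℝ) - y i| 1 with h3 | h3 <;>
  rcases min_cases |(y i : ℝ) - z i| 1 with h4 | h4 <;>
  rcases min_cases |(x i : ℝ) - z i| 1 with h5 | h5 <;> linarith

theorem min_le_dZ (x y : RZ) (i : ℤ) :
    min |(x i : ℝ) - (y i : ℝ)| 1 ≤ 2 ^ (i.natAbs + 1) * dZ x y := by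
  have h := (summable_term x y).le_tsum i (fun j _ => term_nonneg x y j)
  rw [div_le_iff₀ (by positivity)] at h
  rw [mul_comm]; exact h

theorem continuous_dZ (x : RZ) : Continuous (dZ x) := by
  refine continuous_tsum (fun i => ?_) summable_weight (fun i y => ?_)
  · have hi : Continuous fun y : RZ => y i := continuous_apply (A := fun _ : ℤ => ℝ≥0) i
    fun_prop
  · rw [Real.norm_of_nonneg (term_nonneg x y i)]; exact term_le x y i

/-- `dZ` induces the topology of coordinatewise convergence. -/
theorem isOpen_iff_dZ (s : Set RZ) :
    IsOpen s ↔ ∀ x ∈ s, ∃ ε > 0, ∀ y, dZ x y < ε → y ∈ s := by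
  constructor
  · intro hs x hx
    have hF : comap (dZ x) (𝓝 0) ≤ 𝓝 x := by
      have : Tendsto (fun y : RZ => y) (comap (dZ x) (𝓝 0)) (𝓝 x) := by
        refine (tendsto_pi_nhds (A := fun _ : ℤ => ℝ≥0) (f := fun y : RZ => y)).2 ?_
        intro i
        have h0 : Tendsto (dZ x) (comap (dZ x) (𝓝 0)) (𝓝 0) := tendsto_comap
        have h1 := h0.const_mul ((2 : ℝ) ^ (i.natAbs + 1))
        rw [mul_zero] at h1
        rw [Metric.tendsto_nhds]
        intro ε hε
        filter_upwards [h1.eventually (gt_mem_nhds (lt_min hε one_pos))] with y hy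
        have h2 := (min_le_dZ x y i).trans_lt hy
        have h3 : |(x i : ℝ) - y i| < ε := by
          rcases min_lt_iff.1 (h2.trans_le (min_le_left _ _)) with h | h
          · exact h
          · rcases min_lt_iff.1 (h2.trans_le (min_le_right ε 1)) with h' | h'
            · rcases min_cases |(x i : ℝ) - y i| 1 with h5 | h5 <;>
                rcases min_cases ε 1 with h6 | h6 <;> linarith
            · exact absurd h' (lt_irrefl _)
        rw [NNReal.dist_eq, abs_sub_comm]; exact h3
      exact this
    have hs' := hF (hs.mem_nhds hx)
    rw [(Metric.nhds_basis_ball.comap (dZ x)).mem_iff] at hs'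
    obtain ⟨ε, hε, h⟩ := hs'
    refine ⟨ε, hε, fun y hy => h ?_⟩
    have : 0 ≤ dZ x y := tsum_nonneg (term_nonneg x y)
    simpa [abs_of_nonneg this] using hy
  · intro h
    rw [isOpen_iff_mem_nhds]
    intro x hx
    obtain ⟨ε, hε, h⟩ := h x hx
    have : {y | dZ x y < ε} ∈ 𝓝 x :=
      (isOpen_lt (continuous_dZ x) continuous_const).mem_nhds (by simpa [dZ_self] using hε)
    exact mem_of_superset this h

theorem eq_of_dZ_eq_zero (x y : RZ) (h : dZ x y = 0) : x = y := by
  funext i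
  have h1 := min_le_dZ x y i
  rw [h, mul_zero] at h1
  have h2 : |(x i : ℝ) - y i| ≤ 0 := by
    rcases min_le_iff.1 h1 with h | h
    · exact h
    · norm_num at h
  exact NNReal.coe_injective (sub_eq_zero.1 (abs_nonpos_iff.1 h2))

/-- `RZ` with the metric `dZ`. -/
instance : MetricSpace RZ :=
  MetricSpace.ofDistTopology dZ dZ_self dZ_comm dZ_triangle isOpen_iff_dZ eq_of_dZ_eq_zero

/-- The sequence `z e_i`: its `i`-th component is `z`, the others are `0`. -/
def single (i : ℤ) (z : ℝ≥0) : RZ := Pi.single (M := fun _ : ℤ => ℝ≥0) i z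

end RZ

/-! ### The moving average and its limit measure -/

/-- The map `T^∞`, with components `∑_{j ≥ 0} ψ_j z_{k-j}`. -/
def maMap (ψ : ℕ → ℝ≥0) (z : RZ) : RZ := fun k => ∑' j : ℕ, ψ j * z (k - j)

/-- The measure `ν_α(dz) = α z^(-α-1) dz` on `(0, ∞)`, carried by `ℝ≥0`. -/
def nuAlpha (α : ℝ) : Measure ℝ≥0 :=
  ((volume.restrict (Ioi (0 : ℝ))).withDensity
    fun x => ENNReal.ofReal (α * x ^ (-α - 1))).map Real.toNNReal

/-- `ν_α` is the measure with `ν_α(x, ∞) = x^(-α)`. -/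
theorem nuAlpha_Ioi {α : ℝ} (hα : 0 < α) {x : ℝ≥0} (hx : 0 < x) :
    nuAlpha α (Ioi x) = ENNReal.ofReal ((x : ℝ) ^ (-α)) := by
  have hx' : (0 : ℝ) < x := hx
  have hpre : Real.toNNReal ⁻¹' Ioi x = Ioi (x : ℝ) := by
    ext y; simp [Real.lt_toNNReal_iff_coe_lt]
  rw [nuAlpha, Measure.map_apply measurable_real_toNNReal measurableSet_Ioi, hpre,
    withDensity_apply _ measurableSet_Ioi, Measure.restrict_restrict measurableSet_Ioi,
    Ioi_inter_Ioi, sup_eq_left.2 hx'.le]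
  have hint : IntegrableOn (fun y : ℝ => α * y ^ (-α - 1)) (Ioi (x : ℝ)) :=
    (integrableOn_Ioi_rpow_of_lt (by linarith) hx').const_mul α
  rw [← ofReal_integral_eq_lintegral_ofReal hint, integral_const_mul,
    integral_Ioi_rpow_of_lt (by linarith) hx']
  · congr 1
    rw [sub_add_cancel]
    field_simp
  · filter_upwards [ae_restrict_mem measurableSet_Ioi] with y hy
    have : (0 : ℝ) < y := hx'.trans hy
    positivity

/-- The measure `∑_{i ∈ ℤ} ∫ 1{T^∞(z e_i) ∈ ·} ν_α(dz)` on `RZ ∖ {0}`. -/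
def maLimit (α : ℝ) (ψ : ℕ → ℝ≥0) : Measure ↥(({0} : Set RZ)ᶜ) :=
  (Measure.sum fun i : ℤ => (nuAlpha α).map fun z => maMap ψ (RZ.single i z)).comap Subtype.val

/-! ### Regular variation -/

section RV

variable {Ω : Type*} [MeasurableSpace Ω]

/-- `lim_{t → ∞} P[Y > tz] / P[Y > t] = z^(-α)` for all `z > 0`. -/
def RegularlyVaryingTail (P : Measure Ω) (Y : Ω → ℝ≥0) (α : ℝ) : Prop :=
  ∀ z : ℝ≥0, 0 < z →
    Tendsto (fun t : ℝ≥0 => P.real {ω | t * z < Y ω} / P.real {ω | t < Y ω}) atTop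
      (𝓝 ((z : ℝ) ^ (-α)))

/-- `lim_{t → ∞} t P[Y > b(t) z] = z^(-α)` for all `z > 0`. -/
def IsTailScaling (P : Measure Ω) (Y : Ω → ℝ≥0) (α : ℝ) (b : ℝ≥0 → ℝ≥0) : Prop :=
  ∀ z : ℝ≥0, 0 < z →
    Tendsto (fun t : ℝ≥0 => (t : ℝ) * P.real {ω | b t * z < Y ω}) atTop (𝓝 ((z : ℝ) ^ (-α)))

/-- The measure `t P[X / c ∈ ·]` on `RZ ∖ {0}`. -/
def scaledLaw (P : Measure Ω) [IsFiniteMeasure P] (X : Ω → RZ) (t c : ℝ≥0) :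
    MOMeasure ({0} : Set RZ) :=
  MOMeasure.ofFinite {0} (t • P.map fun ω => c⁻¹ • X ω)

/-- The random sequence `X` is regularly varying on `RZ ∖ {0}` with scaling function `b` and
limit measure `μ`: `b` is positive and increasing, `μ` is nonzero, and
`t P[X / b(t) ∈ ·] → μ` in `𝕄(RZ ∖ {0})` as `t → ∞`. -/
structure RegularlyVarying (P : Measure Ω) [IsFiniteMeasure P] (X : Ω → RZ)
    (b : ℝ≥0 → ℝ≥0) (μ : MOMeasure ({0} : Set RZ)) : Prop where
  pos : ∀ t, 0 < b t
  mono : Monotone b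
  ne_zero : μ.toMeasure ≠ 0
  tendsto : Tendsto (fun t : ℝ≥0 => scaledLaw P X t (b t)) atTop (𝓝 μ)

end RV

end

noncomputable section

/-! ### Regularly varying tails -/

/-! The moving average is large because one innovation is large. Let `F` be a Lipschitz test
function vanishing within distance `r` of zero. Then `F (x + v)` differs substantially from `F x + F
v` only if `x` and `v` are both far from zero. For independent blocks of innovations, each far with
probability `O(1 / t)`, this has probability `O(1 / t ^ 2)`, which is negligible after
multiplication by `t`. Hence finitely many innovations contribute additively
(`RZ.LipTest.tendsto_finset`), and each contributes the `ν_α`-integral of `F` along the ray `z ↦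
T^∞(z e_i)` (`IsTailScaling.tendsto_integral_scaledMA_singleton`).

Passing to infinitely many innovations requires a bound uniform in large `t`, namely `t P[∑ c_j Z_j
> b(t)] ≤ K ∑ c_j ^ δ` (`IsTailScaling.measure_weighted_sum_le`). Hölder's inequality with weights
`c_j ^ δ` replaces the sum by truncated `p`-th powers, where `p ≥ 1`, `p > α` and `δ p < α`. A
Karamata-type estimate bounds truncated moments by tails, and a Potter bound compares tails at
different levels; both follow by iterating an inequality over doublings. This single bound gives
almost sure convergence of the series, negligibility of the innovations outside a finite set, and
summability of the contributions, hence finiteness of the limit measure away from zero.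

Continuous test functions are reached by monotone Lipschitz approximation from below, applied to `f`
and to a Lipschitz cutoff minus `f` (`tendsto_lintegral_of_lipTest`). A scaling function is obtained
as a quantile. -/

theorem tail_pos_of_tendsto {U : ℝ≥0 → ℝ} (hU : Antitone U) (hU0 : ∀ x, 0 ≤ U x)
    (h : Tendsto (fun t : ℝ≥0 => U t / U t) atTop (𝓝 1)) (x : ℝ≥0) : 0 < U x := by
  refine lt_of_le_of_ne (hU0 x) fun hx => ?_
  -- Beyond a zero of `U` the quotient is `0 / 0 = 0`, against the limit `1`.
  have : Tendsto (fun t : ℝ≥0 => U t / U t) atTop (𝓝 0) := by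
    refine tendsto_const_nhds.congr' ?_
    filter_upwards [eventually_ge_atTop x] with t ht
    have : U t = 0 := le_antisymm ((hU ht).trans hx.symm.le) (hU0 t)
    simp [this]
  exact one_ne_zero (tendsto_nhds_unique h this)

/-- A bound that survives doubling spreads from `[x, 2x]` to `[x, ∞)`, by induction on the number of
dyadic blocks. It drives both the Potter and the Karamata-type estimates below. -/
theorem le_of_doubling {R : ℝ≥0 → ℝ} {x D : ℝ≥0} {K : ℝ} (hx : 0 < x)
    (hR : ∀ s, x ≤ s → s ≤ 2 * x → R s ≤ K) (hD : D ≤ x)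
    (hstep : ∀ s, D ≤ s → R s ≤ K → R (s * 2) ≤ K) (s : ℝ≥0) (hs : x ≤ s) : R s ≤ K := by
  have key : ∀ n : ℕ, ∀ s, x ≤ s → s ≤ 2 ^ (n + 1) * x → R s ≤ K := by
    intro n
    induction n with
    | zero => intro s h1 h2; exact hR s h1 (by simpa using h2)
    | succ n ih =>
      intro s h1 h2
      by_cases h : s ≤ 2 * x
      · exact hR s h1 h
      · have e : s = s / 2 * 2 := by field_simp
        have h3 : x ≤ s / 2 := by
          rw [le_div_iff₀ two_pos, mul_comm]; exact (not_le.1 h).le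
        rw [e]
        refine hstep _ (hD.trans h3) (ih _ h3 ?_)
        rw [div_le_iff₀ two_pos]
        calc s ≤ _ := h2
          _ = _ := by ring
  obtain ⟨n, hn⟩ := pow_unbounded_of_one_lt (s / x) (one_lt_two : (1 : ℝ≥0) < 2)
  refine key n s hs ?_
  rw [div_lt_iff₀ hx] at hn
  refine hn.le.trans ?_
  gcongr
  · exact one_le_two
  · omega

/-- Moving the exponent slightly off `α` turns the limit into an inequality for all large `t`, which
can then be iterated. -/
theorem eventually_tail_two_mul_le {U : ℝ≥0 → ℝ} {α q : ℝ} (hpos : ∀ x, 0 < U x) (hq : q < α)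
    (h : Tendsto (fun t : ℝ≥0 => U (t * 2) / U t) atTop (𝓝 ((2 : ℝ) ^ (-α)))) :
    ∀ᶠ t in atTop, U (t * 2) ≤ 2 ^ (-q) * U t := by
  have : (2 : ℝ) ^ (-α) < 2 ^ (-q) := Real.rpow_lt_rpow_of_exponent_lt one_lt_two (by linarith)
  filter_upwards [h.eventually (gt_mem_nhds this)] with t ht
  exact ((div_lt_iff₀ (hpos t)).1 ht).le

theorem eventually_le_tail_two_mul {U : ℝ≥0 → ℝ} {α q : ℝ} (hpos : ∀ x, 0 < U x) (hq : α < q)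
    (h : Tendsto (fun t : ℝ≥0 => U (t * 2) / U t) atTop (𝓝 ((2 : ℝ) ^ (-α)))) :
    ∀ᶠ t in atTop, 2 ^ (-q) * U t ≤ U (t * 2) := by
  have : (2 : ℝ) ^ (-q) < 2 ^ (-α) := Real.rpow_lt_rpow_of_exponent_lt one_lt_two (by linarith)
  filter_upwards [h.eventually (lt_mem_nhds this)] with t ht
  exact ((lt_div_iff₀ (hpos t)).1 ht).le

/-- A one-sided Potter bound. -/
theorem tail_le_rpow_mul {U : ℝ≥0 → ℝ} (hU : Antitone U) (hpos : ∀ x, 0 < U x) {q : ℝ}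
    (hq : 0 < q) {x : ℝ≥0} (hx : ∀ s, x ≤ s → U (s * 2) ≤ 2 ^ (-q) * U s) {y s : ℝ≥0}
    (hy : 0 < y) (hxy : x ≤ y) (hs : y ≤ s) : U s ≤ 2 ^ q * U y * ((y / s : ℝ≥0) : ℝ) ^ q := by
  have hy' : (0 : ℝ) < y := hy
  have hs' : (0 : ℝ) < s := hy'.trans_le hs
  -- The left side does not increase when `s` doubles; on `[y, 2y]` it is at most `2 ^ q * U y`,
  -- whence the constant.
  have main : U s * ((s : ℝ) / y) ^ q ≤ 2 ^ q * U y := by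
    refine le_of_doubling (R := fun s => U s * ((s : ℝ) / y) ^ q) hy (fun s h1 h2 => ?_) hxy
      (fun s h1 h2 => ?_) s hs
    · rw [mul_comm]
      have h3 : (s : ℝ) ≤ 2 * y := by exact_mod_cast h2
      have h4 : (s : ℝ) / y ≤ 2 := by rw [div_le_iff₀ hy']; exact h3
      have h5 : U s ≤ U y := hU h1
      have := (hpos s).le
      gcongr
    · refine le_trans ?_ h2
      have h3 : ((s * 2 : ℝ≥0) : ℝ) / y = 2 * (s / y) := by push_cast; ring
      simp only [h3]
      rw [Real.mul_rpow two_pos.le (by positivity)]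
      calc U (s * 2) * (2 ^ q * ((s : ℝ) / y) ^ q)
          ≤ (2 ^ (-q) * U s) * (2 ^ q * ((s : ℝ) / y) ^ q) := by
            gcongr; exact hx s h1
        _ = _ := by rw [Real.rpow_neg two_pos.le]; field_simp
  have e : ((y / s : ℝ≥0) : ℝ) ^ q = (((s : ℝ) / y) ^ q)⁻¹ := by
    rw [← Real.inv_rpow (by positivity), inv_div]; simp
  rw [e, ← div_eq_mul_inv, le_div_iff₀ (by positivity)]
  exact main

/-! ### Truncated moments -/

section Moments

variable {Ω : Type*} [MeasurableSpace Ω]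

/-- The truncated moment `E (1 ∧ (u Y) ^ p)`. -/
def truncMoment (P : Measure Ω) (Y : Ω → ℝ≥0) (p : ℝ) (u : ℝ≥0) : ℝ :=
  ∫ ω, ((min 1 ((u * Y ω) ^ p) : ℝ≥0) : ℝ) ∂P

variable {P : Measure Ω} [IsProbabilityMeasure P] {Y : Ω → ℝ≥0} {p : ℝ}

theorem integrable_truncMoment (hY : Measurable Y) (u : ℝ≥0) :
    Integrable (fun ω => ((min 1 ((u * Y ω) ^ p) : ℝ≥0) : ℝ)) P := by
  refine Integrable.of_bound (C := 1)
    (measurable_const.min ((hY.const_mul u).pow_const p)).coe_nnreal_real.aestronglyMeasurable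
    (ae_of_all _ fun ω => ?_)
  rw [Real.norm_of_nonneg (NNReal.coe_nonneg _)]
  exact_mod_cast min_le_left _ _

theorem integrable_one_indicator {s : Set Ω} (hs : MeasurableSet s) :
    Integrable (s.indicator (1 : Ω → ℝ)) P :=
  (integrable_const (1 : ℝ)).indicator hs

theorem truncMoment_le_one (hY : Measurable Y) (u : ℝ≥0) : truncMoment P Y p u ≤ 1 := by
  refine (integral_mono (integrable_truncMoment hY u) (integrable_const (1 : ℝ)) fun ω => ?_).trans
    (by simp)
  exact_mod_cast min_le_left _ _

/-- Where `Y ≤ s` the truncation of `(Y / s) ^ p` is inactive, so halving the scale gains the full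
factor `2 ^ (-p)`. Where `Y > s` the integrand is at most `1`, which produces the tail term. -/
theorem truncMoment_half (hY : Measurable Y) (hp : 0 < p) {s : ℝ≥0} (hs : 0 < s) :
    truncMoment P Y p (s * 2)⁻¹ ≤ 2 ^ (-p) * truncMoment P Y p s⁻¹ + P.real {ω | s < Y ω} := by
  have hm : MeasurableSet {ω | s < Y ω} := measurableSet_lt measurable_const hY
  rw [truncMoment, truncMoment, ← integral_const_mul, ← integral_indicator_one hm,
    ← integral_add ((integrable_truncMoment hY _).const_mul _)
      (integrable_one_indicator hm)]
  refine integral_mono (integrable_truncMoment hY _)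
    (((integrable_truncMoment hY _).const_mul _).add (integrable_one_indicator hm))
    fun ω => ?_
  by_cases h : s < Y ω
  · have h0 : ω ∈ {ω | s < Y ω} := h
    simp only [indicator_of_mem h0, Pi.one_apply]
    have h1 : ((min 1 (((s * 2)⁻¹ * Y ω) ^ p) : ℝ≥0) : ℝ) ≤ 1 := by
      exact_mod_cast min_le_left _ _
    have h2 : (0 : ℝ) ≤ 2 ^ (-p) * ((min 1 ((s⁻¹ * Y ω) ^ p) : ℝ≥0) : ℝ) := by positivity
    linarith
  · have h0 : ω ∉ {ω | s < Y ω} := h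
    simp only [indicator_of_notMem h0, add_zero]
    have h1 : (s⁻¹ * Y ω) ^ p ≤ 1 := by
      refine NNReal.rpow_le_one ?_ hp.le
      rw [mul_comm, ← div_eq_mul_inv, div_le_one₀ hs]; exact not_lt.1 h
    rw [min_eq_right h1]
    have h2 : ((s * 2)⁻¹ * Y ω) ^ p = 2 ^ (-p) * (s⁻¹ * Y ω) ^ p := by
      rw [mul_inv, mul_comm s⁻¹, mul_assoc, NNReal.mul_rpow, NNReal.inv_rpow, NNReal.rpow_neg]
    have h3 : min 1 (((s * 2)⁻¹ * Y ω) ^ p) ≤ 2 ^ (-p) * (s⁻¹ * Y ω) ^ p := by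
      rw [← h2]; exact min_le_right _ _
    have := NNReal.coe_le_coe.2 h3
    rw [NNReal.coe_mul, NNReal.coe_rpow 2] at this
    exact this

/-- By `truncMoment_half`, the ratio `R` of moment to tail satisfies `R (2s) ≤ ρ R s + 2 ^ q` with
`ρ = 2 ^ (q - p) < 1`. Such a recursion keeps `R` bounded. -/
theorem truncMoment_le_mul_tail (hY : Measurable Y) (hp : 0 < p) {q : ℝ} (hqp : q < p)
    (hpos : ∀ x : ℝ≥0, 0 < P.real {ω | x < Y ω})
    (hlow : ∀ᶠ t : ℝ≥0 in atTop, 2 ^ (-q) * P.real {ω | t < Y ω} ≤ P.real {ω | t * 2 < Y ω}) :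
    ∃ C : ℝ, 0 < C ∧ ∀ᶠ s : ℝ≥0 in atTop,
      truncMoment P Y p s⁻¹ ≤ C * P.real {ω | s < Y ω} := by
  obtain ⟨x₀, hx₀⟩ := eventually_atTop.1 hlow
  set x : ℝ≥0 := max x₀ 1
  have hx : 0 < x := lt_of_lt_of_le one_pos (le_max_right _ _)
  have hanti : Antitone fun x : ℝ≥0 => P.real {ω | x < Y ω} := fun a c h =>
    measureReal_mono fun ω (hω : c < Y ω) => h.trans_lt hω
  set U : ℝ≥0 → ℝ := fun x => P.real {ω | x < Y ω} with hUdef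
  set ρ : ℝ := 2 ^ (q - p)
  have hρ : ρ < 1 := Real.rpow_lt_one_of_one_lt_of_neg one_lt_two (by linarith)
  have hρ0 : 0 < ρ := Real.rpow_pos_of_pos two_pos _
  -- The first entry covers `[x, 2x]`, where the moment is at most `1`; the second makes the bound
  -- invariant, `ρ K + 2 ^ q ≤ K`.
  set K : ℝ := max (1 / U (2 * x)) (2 ^ q / (1 - ρ))
  have hK : 0 < K := lt_of_lt_of_le (one_div_pos.2 (hpos _)) (le_max_left _ _)
  refine ⟨K, hK, eventually_atTop.2 ⟨x, fun s hs => ?_⟩⟩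
  rw [← div_le_iff₀ (hpos s)]
  refine le_of_doubling (R := fun s => truncMoment P Y p s⁻¹ / U s) hx (fun s h1 h2 => ?_)
    le_rfl (fun s h1 h2 => ?_) s hs
  · refine le_trans ?_ (le_max_left _ _)
    have h3 := hanti h2
    have h4 : 0 < U (2 * x) := hpos _
    have := truncMoment_le_one (P := P) (p := p) hY s⁻¹
    exact div_le_div₀ zero_le_one this h4 h3
  · have hs0 : 0 < s := hx.trans_le h1
    have h3 := truncMoment_half (P := P) hY hp hs0
    have h4 : 2 ^ (-q) * U s ≤ U (s * 2) := hx₀ s ((le_max_left _ _).trans h1)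
    have h5 : 0 < U s := hpos s
    have h6 : 0 < U (s * 2) := hpos _
    have h7 : U s ≤ 2 ^ q * U (s * 2) := by
      rw [Real.rpow_neg two_pos.le, inv_mul_le_iff₀ (by positivity)] at h4; exact h4
    rw [div_le_iff₀ h5] at h2
    rw [div_le_iff₀ h6]
    have h8 : 2 ^ q ≤ K * (1 - ρ) := by
      rw [← div_le_iff₀ (by linarith)]; exact le_max_right _ _
    have h9 : (2 : ℝ) ^ (-p) * 2 ^ q = ρ := by
      rw [← Real.rpow_add two_pos]; congr 1; ring
    have h10 : (0 : ℝ) < 2 ^ (-p) := by positivity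
    calc truncMoment P Y p (s * 2)⁻¹ ≤ 2 ^ (-p) * truncMoment P Y p s⁻¹ + U s := h3
      _ ≤ 2 ^ (-p) * (K * (2 ^ q * U (s * 2))) + 2 ^ q * U (s * 2) := by
        gcongr; exact h2.trans (by gcongr)
      _ = (ρ * K + 2 ^ q) * U (s * 2) := by rw [← h9]; ring
      _ ≤ K * U (s * 2) := by gcongr; linarith

theorem truncMoment_mul_le (hY : Measurable Y) (hp : 0 < p) {B : ℝ≥0} (hB : 1 ≤ B) (u : ℝ≥0) :
    truncMoment P Y p (B * u) ≤ (B : ℝ) ^ p * truncMoment P Y p u := by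
  rw [truncMoment, truncMoment, ← integral_const_mul]
  refine integral_mono (integrable_truncMoment hY _) ((integrable_truncMoment hY _).const_mul _)
    fun ω => ?_
  have h : min 1 ((B * u * Y ω) ^ p) ≤ B ^ p * min 1 ((u * Y ω) ^ p) := by
    rw [mul_assoc, NNReal.mul_rpow, mul_min_of_nonneg _ _ zero_le, mul_one]
    exact min_le_min_right _ (NNReal.one_le_rpow hB hp.le)
  have := NNReal.coe_le_coe.2 h
  rw [NNReal.coe_mul, NNReal.coe_rpow B] at this
  exact this

/-! ### Scaling functions -/

variable {α : ℝ} {b : ℝ≥0 → ℝ≥0}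

theorem antitone_tail : Antitone fun x : ℝ≥0 => P.real {ω | x < Y ω} := fun _ c h =>
  measureReal_mono fun ω (hω : c < Y ω) => h.trans_lt hω

theorem RegularlyVaryingTail.pos (h : RegularlyVaryingTail P Y α) (x : ℝ≥0) :
    0 < P.real {ω | x < Y ω} :=
  tail_pos_of_tendsto antitone_tail (fun _ => measureReal_nonneg)
    (by simpa using h 1 one_pos) x

omit [IsProbabilityMeasure P] in
theorem RegularlyVaryingTail.two (h : RegularlyVaryingTail P Y α) :
    Tendsto (fun t : ℝ≥0 => P.real {ω | t * 2 < Y ω} / P.real {ω | t < Y ω}) atTop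
      (𝓝 ((2 : ℝ) ^ (-α))) := by
  simpa using h 2 two_pos

/-- If `b t < x`, then `t P[Y > b t]` is at least `t P[Y > x]`, which is eventually too large for
the limit `1`. -/
theorem IsTailScaling.tendsto_atTop (hpos : ∀ x : ℝ≥0, 0 < P.real {ω | x < Y ω})
    (hb : IsTailScaling P Y α b) : Tendsto b atTop atTop := by
  rw [Filter.tendsto_atTop]
  intro x
  have h1 : Tendsto (fun t : ℝ≥0 => (t : ℝ) * P.real {ω | b t < Y ω}) atTop (𝓝 1) := by
    simpa using hb 1 one_pos
  have h2 : Tendsto (fun t : ℝ≥0 => (t : ℝ) * P.real {ω | x < Y ω}) atTop atTop :=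
    Tendsto.atTop_mul_const (hpos x) (NNReal.tendsto_coe_atTop.2 tendsto_id)
  filter_upwards [h1.eventually (gt_mem_nhds one_lt_two), h2.eventually_ge_atTop 2] with t ht ht'
  by_contra! h
  have := antitone_tail (P := P) (Y := Y) h.le
  have h3 : (t : ℝ) * P.real {ω | x < Y ω} ≤ t * P.real {ω | b t < Y ω} := by gcongr
  linarith

/-- The truncated moment at scale `b t / u` is at most a constant times the tail there; the Potter
bound compares that with the tail at `b t`, at the price `u ^ q`, and `t P[Y > b t]` is eventually
below `2`. -/
theorem IsTailScaling.truncMoment_le (hY : Measurable Y) (hp : 0 < p) {q : ℝ} (hq : 0 < q)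
    (hqα : q < α) (hαp : α < p) (htail : RegularlyVaryingTail P Y α)
    (hb : IsTailScaling P Y α b) (B : ℝ≥0) :
    ∃ K : ℝ≥0, ∀ᶠ t : ℝ≥0 in atTop, ∀ u : ℝ≥0, u ≤ B →
      (t : ℝ) * truncMoment P Y p (u * (b t)⁻¹) ≤ K * (u : ℝ) ^ q := by
  obtain ⟨q', h1, h2⟩ := exists_between hαp
  have hpos := htail.pos
  obtain ⟨C, hC, hC'⟩ := truncMoment_le_mul_tail hY hp h2 hpos
    (eventually_le_tail_two_mul hpos h1 htail.two)
  obtain ⟨x₁, hx₁⟩ := eventually_atTop.1 hC'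
  obtain ⟨x₂, hx₂⟩ := eventually_atTop.1 (eventually_tail_two_mul_le hpos hqα htail.two)
  have hlim : Tendsto (fun t : ℝ≥0 => (t : ℝ) * P.real {ω | b t < Y ω}) atTop (𝓝 1) := by
    simpa using hb 1 one_pos
  have hbtop := hb.tendsto_atTop hpos
  set B' : ℝ≥0 := max B 1
  have hB' : 0 < B' := lt_of_lt_of_le one_pos (le_max_right _ _)
  refine ⟨B' ^ p * (2 * C.toNNReal * 2 ^ q), ?_⟩
  filter_upwards [hbtop.eventually_ge_atTop x₁, hbtop.eventually_ge_atTop x₂,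
    hbtop.eventually_gt_atTop 0, hlim.eventually (gt_mem_nhds one_lt_two)] with t ht1 ht2 ht3 ht4
  intro u hu
  rcases eq_or_ne u 0 with rfl | hu0
  · have : truncMoment P Y p (0 * (b t)⁻¹) = 0 := by
      simp [truncMoment, NNReal.zero_rpow hp.ne']
    rw [this]; simp [Real.zero_rpow hq.ne']
  have hu0 : 0 < u := pos_iff_ne_zero.2 hu0
  -- Normalizing to `v ≤ 1` puts `b t / v` above `b t`, the range of the Potter bound; removing the
  -- normalization costs `B' ^ p`.
  set v := u / B'
  have hv0 : 0 < v := div_pos hu0 hB'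
  have hv1 : v ≤ 1 := (div_le_one₀ hB').2 (hu.trans (le_max_left _ _))
  have e : u * (b t)⁻¹ = B' * (v * (b t)⁻¹) := by simp only [v]; field_simp
  have hbs : b t ≤ b t / v := by
    rw [le_div_iff₀ hv0]; exact mul_le_of_le_one_right zero_le hv1
  have h3 := hx₁ (b t / v) (ht1.trans hbs)
  have h4 := tail_le_rpow_mul (U := fun x => P.real {ω | x < Y ω}) antitone_tail hpos hq hx₂
    ht3 ht2 hbs
  have e2 : (b t / v)⁻¹ = v * (b t)⁻¹ := by rw [inv_div, div_eq_mul_inv]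
  have e3 : b t / (b t / v) = v := by field_simp
  rw [e2] at h3
  rw [e3] at h4
  have hvu : v ≤ u := by
    simp only [v]; rw [div_le_iff₀ hB']; exact le_mul_of_one_le_right zero_le (le_max_right _ _)
  rw [e]
  calc (t : ℝ) * truncMoment P Y p (B' * (v * (b t)⁻¹))
      ≤ t * ((B' : ℝ) ^ p * (C * (2 ^ q * P.real {ω | b t < Y ω} * (v : ℝ) ^ q))) := by
        gcongr
        refine (truncMoment_mul_le hY hp (le_max_right _ _) _).trans ?_
        gcongr
        refine h3.trans ?_
        gcongr
    _ = (B' : ℝ) ^ p * (C * 2 ^ q) * (v : ℝ) ^ q * (t * P.real {ω | b t < Y ω}) := by ring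
    _ ≤ (B' : ℝ) ^ p * (C * 2 ^ q) * (u : ℝ) ^ q * 2 := by gcongr
    _ = _ := by
      push_cast
      rw [Real.coe_toNNReal _ hC.le]
      ring

end Moments

/-! ### Weighted sums of heavy-tailed variables -/

section WeightedSum

/-- If a weighted sum exceeds `1`, then so does a sum of truncated powers of its terms. -/
theorem one_le_sum_truncated {ι : Type*} (s : Finset ι) (c z : ι → ℝ≥0) {δ p : ℝ} (hδ : 0 < δ)
    (hp : 1 ≤ p) {A : ℝ≥0} (hA : ∑ j ∈ s, c j ^ δ ≤ A) (h : 1 < ∑ j ∈ s, c j * z j) :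
    1 ≤ A ^ (p - 1) * ∑ j ∈ s, c j ^ (δ * (1 - p)) * min 1 ((c j * z j) ^ p) := by
  have hp0 : 0 < p := one_pos.trans_le hp
  -- A single term above `1` suffices: its truncated power is `1`, and `c j ^ δ ≤ A` compensates for
  -- the factor `c j ^ (δ * (1 - p))`.
  by_cases hbig : ∃ j ∈ s, 1 < c j * z j
  · obtain ⟨j, hj, h1⟩ := hbig
    have hc : c j ≠ 0 := by rintro h0; simp [h0] at h1
    have h2 : c j ^ δ ≤ A :=
      (Finset.single_le_sum (f := fun j => c j ^ δ) (fun _ _ => zero_le) hj).trans hA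
    have h3 : min 1 ((c j * z j) ^ p) = 1 := min_eq_left (NNReal.one_le_rpow h1.le hp0.le)
    calc (1 : ℝ≥0) = (c j ^ δ) ^ (p - 1) * (c j ^ (δ * (1 - p)) * min 1 ((c j * z j) ^ p)) := by
          rw [h3, mul_one, ← NNReal.rpow_mul, ← NNReal.rpow_add hc,
            show δ * (p - 1) + δ * (1 - p) = 0 by ring, NNReal.rpow_zero]
      _ ≤ A ^ (p - 1) * (c j ^ (δ * (1 - p)) * min 1 ((c j * z j) ^ p)) := by
          gcongr
      _ ≤ _ := by
          gcongr
          exact Finset.single_le_sum (f := fun j => c j ^ (δ * (1 - p)) * min 1 ((c j * z j) ^ p))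
            (fun _ _ => zero_le) hj
  · push Not at hbig
    have e1 : ∀ j ∈ s, c j * z j = c j ^ δ * (c j ^ (1 - δ) * z j) := by
      intro j _
      rcases eq_or_ne (c j) 0 with h0 | h0
      · simp [h0, NNReal.zero_rpow hδ.ne']
      · rw [← mul_assoc, ← NNReal.rpow_add h0, add_sub_cancel, NNReal.rpow_one]
    have e2 : ∀ j ∈ s, c j ^ δ * (c j ^ (1 - δ) * z j) ^ p =
        c j ^ (δ * (1 - p)) * min 1 ((c j * z j) ^ p) := by
      intro j hj
      rw [min_eq_right (NNReal.rpow_le_one (hbig j hj) hp0.le)]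
      rcases eq_or_ne (c j) 0 with h0 | h0
      · simp [h0, NNReal.zero_rpow hδ.ne', NNReal.zero_rpow hp0.ne']
      · rw [NNReal.mul_rpow, NNReal.mul_rpow, ← NNReal.rpow_mul, ← mul_assoc, ← mul_assoc,
          ← NNReal.rpow_add h0, ← NNReal.rpow_add h0]
        congr 2; ring
    -- When no term exceeds `1`, the truncation is inactive and Hölder's inequality with weights `c
    -- j ^ δ` applies to the factors `c j ^ (1 - δ) * z j`.
    have hold := NNReal.inner_le_weight_mul_Lp s hp (fun j => c j ^ δ)
      (fun j => c j ^ (1 - δ) * z j)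
    rw [← Finset.sum_congr rfl e1, Finset.sum_congr rfl e2] at hold
    have h4 := NNReal.rpow_le_rpow (h.le.trans hold) hp0.le
    rw [NNReal.one_rpow, NNReal.mul_rpow, ← NNReal.rpow_mul, ← NNReal.rpow_mul,
      inv_mul_cancel₀ hp0.ne', NNReal.rpow_one] at h4
    refine h4.trans ?_
    gcongr
    rw [sub_mul, one_mul, inv_mul_cancel₀ hp0.ne']
    exact NNReal.rpow_le_rpow hA (by linarith)

variable {Ω : Type*} [MeasurableSpace Ω] {P : Measure Ω} [IsProbabilityMeasure P] {Y : Ω → ℝ≥0}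
  {α δ p : ℝ} {b : ℝ≥0 → ℝ≥0}

omit [IsProbabilityMeasure P] in
-- Markov's inequality for the bound of `one_le_sum_truncated`. With the series taken in `ℝ≥0∞`,
-- exceeding `1` is witnessed by a finite partial sum, so divergent series are included.
theorem measure_one_lt_tsum_le {ι : Type*} [Countable ι] {c : ι → ℝ≥0} {W : ι → Ω → ℝ≥0}
    (hW : ∀ j, Measurable (W j)) (hδ : 0 < δ) (hp : 1 ≤ p) {A : ℝ≥0}
    (hA : ∑' j, ((c j ^ δ : ℝ≥0) : ℝ≥0∞) ≤ A) :
    P {ω | 1 < ∑' j, ((c j * W j ω : ℝ≥0) : ℝ≥0∞)} ≤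
      (A ^ (p - 1) : ℝ≥0) * ∑' j, ((c j ^ (δ * (1 - p)) : ℝ≥0) : ℝ≥0∞) *
        ∫⁻ ω, ((min 1 ((c j * W j ω) ^ p) : ℝ≥0) : ℝ≥0∞) ∂P := by
  have hmeas : ∀ j, Measurable fun ω => ((min 1 ((c j * W j ω) ^ p) : ℝ≥0) : ℝ≥0∞) := fun j =>
    (measurable_const.min (((hW j).const_mul (c j)).pow_const p)).coe_nnreal_ennreal
  have hsum : Measurable fun ω => ∑' j, ((c j ^ (δ * (1 - p)) : ℝ≥0) : ℝ≥0∞) *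
      ((min 1 ((c j * W j ω) ^ p) : ℝ≥0) : ℝ≥0∞) := Measurable.tsum fun j => (hmeas j).const_mul _
  have hpt : ∀ ω, 1 < ∑' j, ((c j * W j ω : ℝ≥0) : ℝ≥0∞) →
      (1 : ℝ≥0∞) ≤ (A ^ (p - 1) : ℝ≥0) * ∑' j, ((c j ^ (δ * (1 - p)) : ℝ≥0) : ℝ≥0∞) *
        ((min 1 ((c j * W j ω) ^ p) : ℝ≥0) : ℝ≥0∞) := by
    intro ω hω
    rw [ENNReal.tsum_eq_iSup_sum, lt_iSup_iff] at hω
    obtain ⟨s, hs⟩ := hω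
    have h1 := one_le_sum_truncated s c (fun j => W j ω) hδ hp
      (A := A) (by exact_mod_cast (ENNReal.sum_le_tsum s).trans hA) (by exact_mod_cast hs)
    have h2 : (1 : ℝ≥0∞) ≤ (A ^ (p - 1) : ℝ≥0) * ∑ j ∈ s,
        ((c j ^ (δ * (1 - p)) : ℝ≥0) : ℝ≥0∞) * ((min 1 ((c j * W j ω) ^ p) : ℝ≥0) : ℝ≥0∞) := by
      exact_mod_cast h1
    refine h2.trans ?_
    gcongr
    exact ENNReal.sum_le_tsum s
  calc P {ω | 1 < ∑' j, ((c j * W j ω : ℝ≥0) : ℝ≥0∞)}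
      ≤ P {ω | 1 ≤ (A ^ (p - 1) : ℝ≥0) * ∑' j, ((c j ^ (δ * (1 - p)) : ℝ≥0) : ℝ≥0∞) *
        ((min 1 ((c j * W j ω) ^ p) : ℝ≥0) : ℝ≥0∞)} := measure_mono hpt
    _ ≤ ∫⁻ ω, (A ^ (p - 1) : ℝ≥0) * ∑' j, ((c j ^ (δ * (1 - p)) : ℝ≥0) : ℝ≥0∞) *
        ((min 1 ((c j * W j ω) ^ p) : ℝ≥0) : ℝ≥0∞) ∂P := by
      have := mul_meas_ge_le_lintegral (μ := P)
        (hsum.const_mul ((A ^ (p - 1) : ℝ≥0) : ℝ≥0∞)) 1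
      simpa using this
    _ = _ := by
      rw [lintegral_const_mul _ hsum,
        lintegral_tsum fun j => ((hmeas j).const_mul _).aemeasurable]
      simp_rw [lintegral_const_mul _ (hmeas _)]

theorem lintegral_truncated_eq (hY : Measurable Y) {W : Ω → ℝ≥0} (hW : IdentDistrib W Y P P)
    (c u : ℝ≥0) :
    ∫⁻ ω, ((min 1 ((c * (u * W ω)) ^ p) : ℝ≥0) : ℝ≥0∞) ∂P =
      ENNReal.ofReal (truncMoment P Y p (c * u)) := by
  have hg : Measurable fun y : ℝ≥0 => ((min 1 ((c * (u * y)) ^ p) : ℝ≥0) : ℝ≥0∞) :=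
    (measurable_const.min (((measurable_id.const_mul u).const_mul c).pow_const p)).coe_nnreal_ennreal
  have h1 := (hW.comp hg).lintegral_eq
  simp only [Function.comp_def] at h1
  rw [h1, truncMoment, ofReal_integral_eq_lintegral_ofReal (integrable_truncMoment hY _)
    (ae_of_all _ fun _ => NNReal.coe_nonneg _)]
  simp only [mul_assoc, ENNReal.ofReal_coe_nnreal]

/-- The probability that a weighted sum of heavy-tailed variables is large is controlled by the
sum of the `δ`-powers of the weights, uniformly in the weights. -/
theorem IsTailScaling.measure_weighted_sum_le (hY : Measurable Y) (hδ : 0 < δ) (hδ1 : δ < min α 1)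
    (htail : RegularlyVaryingTail P Y α) (hb : IsTailScaling P Y α b) (A : ℝ≥0)
    (ι : Type*) [Countable ι] :
    ∃ K : ℝ≥0, ∀ᶠ t : ℝ≥0 in atTop, ∀ (W : ι → Ω → ℝ≥0), (∀ j, Measurable (W j)) →
      (∀ j, IdentDistrib (W j) Y P P) → ∀ c : ι → ℝ≥0, ∑' j, ((c j ^ δ : ℝ≥0) : ℝ≥0∞) ≤ A →
      t * P {ω | 1 < ∑' j, ((c j * ((b t)⁻¹ * W j ω) : ℝ≥0) : ℝ≥0∞)} ≤
        K * ∑' j, ((c j ^ δ : ℝ≥0) : ℝ≥0∞) := by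
  have hδα := hδ1.trans_le (min_le_left _ _)
  have hδ1' := hδ1.trans_le (min_le_right _ _)
  -- Hölder needs `p ≥ 1`, the moment bound needs `p > α`, and the Potter bound with exponent `δ *
  -- p` needs `δ * p < α`.
  obtain ⟨p, hp1, hαp, hpα⟩ : ∃ p, 1 ≤ p ∧ α < p ∧ δ * p < α := by
    by_cases h : α < 1
    · exact ⟨1, le_rfl, h, by linarith⟩
    · rw [not_lt] at h
      obtain ⟨p, h1, h2⟩ : ∃ p, α < p ∧ p < α / δ := by
        refine exists_between ?_
        rw [lt_div_iff₀ hδ]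
        nlinarith
      exact ⟨p, h.trans h1.le, h1, by rw [lt_div_iff₀ hδ] at h2; linarith⟩
  have hp0 : 0 < p := one_pos.trans_le hp1
  -- The estimate is used at `u = c j`, and `c j ^ δ ≤ A` gives `c j ≤ A ^ δ⁻¹`. The exponent `δ *
  -- p` is chosen so that `c j ^ (δ * (1 - p)) * c j ^ (δ * p) = c j ^ δ`.
  obtain ⟨K, hK⟩ := hb.truncMoment_le hY hp0 (mul_pos hδ hp0) hpα hαp htail (A ^ δ⁻¹)
  refine ⟨A ^ (p - 1) * K, ?_⟩
  filter_upwards [hK] with t ht W hW hWY c hc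
  have hcB : ∀ j, c j ≤ A ^ δ⁻¹ := by
    intro j
    have h1 : c j ^ δ ≤ A := by exact_mod_cast (ENNReal.le_tsum j).trans hc
    have h2 := NNReal.rpow_le_rpow h1 (inv_nonneg.2 hδ.le)
    rwa [← NNReal.rpow_mul, mul_inv_cancel₀ hδ.ne', NNReal.rpow_one] at h2
  have hterm : ∀ j, (t : ℝ≥0∞) * ENNReal.ofReal (truncMoment P Y p (c j * (b t)⁻¹)) ≤
      ((K * c j ^ (δ * p) : ℝ≥0) : ℝ≥0∞) := by
    intro j
    rw [← ENNReal.ofReal_coe_nnreal (p := t), ← ENNReal.ofReal_mul t.coe_nonneg,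
      ← ENNReal.ofReal_coe_nnreal (p := K * _)]
    refine ENNReal.ofReal_le_ofReal ?_
    rw [NNReal.coe_mul, NNReal.coe_rpow]
    exact ht (c j) (hcB j)
  calc (t : ℝ≥0∞) * P {ω | 1 < ∑' j, ((c j * ((b t)⁻¹ * W j ω) : ℝ≥0) : ℝ≥0∞)}
      ≤ t * ((A ^ (p - 1) : ℝ≥0) * ∑' j, ((c j ^ (δ * (1 - p)) : ℝ≥0) : ℝ≥0∞) *
        ENNReal.ofReal (truncMoment P Y p (c j * (b t)⁻¹))) := by
        gcongr
        refine (measure_one_lt_tsum_le (fun j => (hW j).const_mul (b t)⁻¹) hδ hp1 hc).trans_eq ?_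
        simp_rw [lintegral_truncated_eq hY (hWY _)]
    _ = (A ^ (p - 1) : ℝ≥0) * ∑' j, ((c j ^ (δ * (1 - p)) : ℝ≥0) : ℝ≥0∞) *
        (t * ENNReal.ofReal (truncMoment P Y p (c j * (b t)⁻¹))) := by
        rw [mul_left_comm, ← ENNReal.tsum_mul_left]
        simp_rw [mul_left_comm]
    _ ≤ (A ^ (p - 1) : ℝ≥0) * ∑' j, ((c j ^ (δ * (1 - p)) : ℝ≥0) : ℝ≥0∞) *
        ((K * c j ^ (δ * p) : ℝ≥0) : ℝ≥0∞) := by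
        gcongr with j
        exact hterm j
    _ = _ := by
        rw [ENNReal.coe_mul, mul_assoc, ← ENNReal.tsum_mul_left (a := (K : ℝ≥0∞))]
        congr 2
        ext j
        norm_cast
        rw [mul_left_comm]
        congr 1
        rcases eq_or_ne (c j) 0 with h0 | h0
        · rw [h0, NNReal.zero_rpow (mul_pos hδ hp0).ne', mul_zero, NNReal.zero_rpow hδ.ne']
        · rw [← NNReal.rpow_add h0]
          congr 1; ring

end WeightedSum

/-! ### Restricted moving averages -/

namespace RZ

instance : AddCommMonoid RZ := inferInstanceAs (AddCommMonoid (ℤ → ℝ≥0))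

theorem add_apply (x y : RZ) (k : ℤ) : (x + y) k = x k + y k := rfl

theorem smul_apply (c : ℝ≥0) (x : RZ) (k : ℤ) : (c • x) k = c * x k := rfl

theorem zero_apply (k : ℤ) : (0 : RZ) k = 0 := rfl

/-- The restriction of a sequence to a set of indices. -/
def restr (S : Set ℤ) (z : RZ) : RZ := fun k => S.indicator (fun i => z i) k

theorem restr_of_mem {S : Set ℤ} {k : ℤ} (h : k ∈ S) (z : RZ) : restr S z k = z k :=
  indicator_of_mem h _

theorem restr_of_notMem {S : Set ℤ} {k : ℤ} (h : k ∉ S) (z : RZ) : restr S z k = 0 :=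
  indicator_of_notMem h _

theorem restr_univ (z : RZ) : restr univ z = z := funext fun k => restr_of_mem (mem_univ k) z

theorem restr_empty (z : RZ) : restr ∅ z = 0 := funext fun k => restr_of_notMem (notMem_empty k) z

theorem single_same (i : ℤ) (c : ℝ≥0) : single i c i = c :=
  Pi.single_eq_same (M := fun _ : ℤ => ℝ≥0) i c

theorem single_of_ne {i k : ℤ} (h : k ≠ i) (c : ℝ≥0) : single i c k = 0 :=
  Pi.single_eq_of_ne (M := fun _ : ℤ => ℝ≥0) h c

theorem restr_singleton (i : ℤ) (z : RZ) : restr {i} z = single i (z i) := by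
  funext k
  by_cases h : k = i
  · rw [h, restr_of_mem (mem_singleton i), single_same]
  · rw [restr_of_notMem (S := {i}) h, single_of_ne h]

theorem restr_union {S T : Set ℤ} (h : Disjoint S T) (z : RZ) :
    restr (S ∪ T) z = restr S z + restr T z :=
  funext fun k => congrFun (indicator_union_of_disjoint h fun i => z i) k

theorem restr_le (S : Set ℤ) (z : RZ) (k : ℤ) : restr S z k ≤ z k :=
  indicator_le_self (s := S) (f := fun i => z i) k

theorem measurable_apply (k : ℤ) : Measurable fun x : RZ => x k :=
  measurable_pi_apply (X := fun _ : ℤ => ℝ≥0) k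

theorem measurable_iff {β : Type*} [MeasurableSpace β] {f : β → RZ} :
    Measurable f ↔ ∀ k, Measurable fun x => f x k :=
  measurable_pi_iff (X := fun _ : ℤ => ℝ≥0)

theorem measurable_restr (S : Set ℤ) : Measurable (restr S) := by
  refine measurable_iff.2 fun k => ?_
  by_cases h : k ∈ S
  · simpa only [restr_of_mem h] using measurable_apply k
  · simpa only [restr_of_notMem h] using measurable_const

theorem measurable_const_smul (c : ℝ≥0) : Measurable fun x : RZ => c • x :=
  measurable_iff.2 fun k => (measurable_apply k).const_mul c

/-- A sequence is close to zero if finitely many of its components are small. -/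
theorem exists_dZ_zero_lt {ε : ℝ} (hε : 0 < ε) :
    ∃ K : Finset ℤ, ∃ η : ℝ≥0, 0 < η ∧ ∀ x : RZ, (∀ k ∈ K, x k ≤ η) → dZ x 0 < ε := by
  set w : ℤ → ℝ := fun i => 1 / 2 ^ (i.natAbs + 1) with hw
  have hw0 : ∀ i, 0 ≤ w i := fun i => by positivity
  -- Since the terms of the metric are truncated at `1`, coordinates outside `K` contribute less
  -- than `ε / 2` whatever their size.
  obtain ⟨K, hK⟩ : ∃ K : Finset ℤ, ∑' i : {i // i ∉ K}, w i < ε / 2 :=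
    ((tendsto_order.1 (tendsto_tsum_compl_atTop_zero w)).2 _ (half_pos hε)).exists
  set c : ℝ := ∑ i ∈ K, w i
  have hc : 0 ≤ c := Finset.sum_nonneg fun i _ => hw0 i
  refine ⟨K, (ε / (2 * (c + 1))).toNNReal, Real.toNNReal_pos.2 (by positivity), fun x hx => ?_⟩
  have hs := summable_term x 0
  unfold dZ
  rw [← hs.sum_add_tsum_subtype_compl K]
  have h1 : ∑ i ∈ K, min |(x i : ℝ) - ((0 : RZ) i : ℝ)| 1 / 2 ^ (i.natAbs + 1) ≤
      ∑ i ∈ K, ε / (2 * (c + 1)) * w i := by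
    refine Finset.sum_le_sum fun i hi => ?_
    rw [hw, mul_one_div]
    gcongr
    refine (min_le_left _ _).trans ?_
    rw [zero_apply, NNReal.coe_zero, sub_zero, abs_of_nonneg (NNReal.coe_nonneg _)]
    have := NNReal.coe_le_coe.2 (hx i hi)
    rwa [Real.coe_toNNReal _ (by positivity)] at this
  have h2 : ∑' i : {i // i ∉ K}, min |(x i : ℝ) - ((0 : RZ) i : ℝ)| 1 / 2 ^ ((i : ℤ).natAbs + 1) ≤
      ∑' i : {i // i ∉ K}, w i :=
    (hs.subtype _).tsum_le_tsum (fun i => term_le x 0 i) (summable_weight.subtype _)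
  have h3 : ∑ i ∈ K, ε / (2 * (c + 1)) * w i ≤ ε / 2 := by
    rw [← Finset.mul_sum]
    change ε / (2 * (c + 1)) * c ≤ ε / 2
    rw [div_mul_eq_mul_div, div_le_div_iff₀ (by positivity) two_pos]
    nlinarith
  linarith

end RZ

open RZ

theorem maMap_smul (ψ : ℕ → ℝ≥0) (c : ℝ≥0) (z : RZ) : maMap ψ (c • z) = c • maMap ψ z := by
  funext k
  rw [smul_apply, maMap, maMap, ← NNReal.tsum_mul_left]
  exact tsum_congr fun j => mul_left_comm _ _ _

theorem maMap_zero (ψ : ℕ → ℝ≥0) : maMap ψ 0 = 0 := by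
  funext k
  simp [maMap, zero_apply]

theorem maMap_add (ψ : ℕ → ℝ≥0) {x y : RZ} (hx : ∀ k : ℤ, Summable fun j : ℕ => ψ j * x (k - j))
    (hy : ∀ k : ℤ, Summable fun j : ℕ => ψ j * y (k - j)) :
    maMap ψ (x + y) = maMap ψ x + maMap ψ y := by
  funext k
  rw [add_apply, maMap, maMap, maMap, ← (hx k).tsum_add (hy k)]
  exact tsum_congr fun j => mul_add _ _ _

theorem measurable_maMap (ψ : ℕ → ℝ≥0) : Measurable (maMap ψ) := by
  refine measurable_iff.2 fun k => ?_
  unfold maMap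
  exact Measurable.tsum fun j => (measurable_apply _).const_mul _

/-- Divergence gives `0` on the left and `∞` on the right, so no summability is needed. -/
theorem coe_tsum_le (f : ℕ → ℝ≥0) : ((∑' j, f j : ℝ≥0) : ℝ≥0∞) ≤ ∑' j, (f j : ℝ≥0∞) := by
  by_cases h : Summable f
  · rw [ENNReal.coe_tsum h]
  · simp [tsum_eq_zero_of_not_summable h]

/-! ### Uniform tail bounds for restricted moving averages -/

section

variable {Ω : Type*} [MeasurableSpace Ω] {P : Measure Ω} [IsProbabilityMeasure P]
  {Z : ℤ → Ω → ℝ≥0} {α δ : ℝ} {ψ : ℕ → ℝ≥0} {b : ℝ≥0 → ℝ≥0}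

/-- Restricting to `S` sets some weights `ψ j / η` to zero and so does not increase the sum of their
`δ`-powers. One constant therefore serves all `S`, and the innovation `i ≤ k` is charged `K * (ψ (k
- i) / η) ^ δ`. -/
theorem IsTailScaling.measure_coordinate_le (hmeas : ∀ i, Measurable (Z i))
    (hident : ∀ i, IdentDistrib (Z i) (Z 0) P P) (htail : RegularlyVaryingTail P (Z 0) α)
    (hδ : 0 < δ) (hδ1 : δ < min α 1) (hψ : Summable fun j => ψ j ^ δ)
    (hb : IsTailScaling P (Z 0) α b) (k : ℤ) {η : ℝ≥0} (hη : 0 < η) :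
    ∃ a : ℤ → ℝ≥0, Summable a ∧ ∀ᶠ t : ℝ≥0 in atTop, ∀ S : Set ℤ,
      t * P {ω | η < ∑' j : ℕ, ((ψ j * ((b t)⁻¹ * restr S (fun i => Z i ω) (k - j)) : ℝ≥0) : ℝ≥0∞)}
        ≤ ∑' i, S.indicator (fun i => (a i : ℝ≥0∞)) i := by
  set c : ℕ → ℝ≥0 := fun j => ψ j / η with hc
  have hcs : Summable fun j => c j ^ δ := by
    simp only [hc, NNReal.div_rpow]; exact hψ.div_const _
  obtain ⟨K, hK⟩ := hb.measure_weighted_sum_le (hmeas 0) hδ hδ1 htail (∑' j, c j ^ δ) ℕ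
  set a : ℤ → ℝ≥0 := fun i => if i ≤ k then c (k - i).toNat ^ δ else 0 with ha
  have hak : ∀ j : ℕ, a (k - j) = c j ^ δ := by
    intro j
    simp [ha]
  have hinj : Function.Injective fun j : ℕ => k - (j : ℤ) := by
    intro i j h; simpa using h
  have has : Summable a := by
    rw [← hinj.summable_iff]
    · exact hcs.congr fun j => (hak j).symm
    · intro i hi
      simp only [ha]
      rw [if_neg]
      intro h
      exact hi ⟨(k - i).toNat, by simp [Int.toNat_of_nonneg (sub_nonneg.2 h)]⟩
  refine ⟨fun i => K * a i, has.mul_left K, ?_⟩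
  filter_upwards [hK] with t ht S
  classical
  set cS : ℕ → ℝ≥0 := fun j => if k - (j : ℤ) ∈ S then c j else 0 with hcS
  have hcS' : ∀ j, ((cS j ^ δ : ℝ≥0) : ℝ≥0∞) = S.indicator (fun i => (a i : ℝ≥0∞)) (k - j) := by
    intro j
    by_cases h : k - (j : ℤ) ∈ S
    · simp [hcS, h, hak]
    · simp [hcS, h, NNReal.zero_rpow hδ.ne']
  have hle : ∑' j, ((cS j ^ δ : ℝ≥0) : ℝ≥0∞) ≤ (∑' j, c j ^ δ : ℝ≥0) := by
    rw [ENNReal.coe_tsum hcs]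
    refine ENNReal.tsum_le_tsum fun j => ?_
    rw [hcS', ← hak]
    exact indicator_le_self' (fun _ _ => zero_le) _
  have h1 := ht (fun j => Z (k - j)) (fun j => hmeas _) (fun j => hident _) cS hle
  have hset : {ω | (η : ℝ≥0∞) < ∑' j : ℕ,
      ((ψ j * ((b t)⁻¹ * restr S (fun i => Z i ω) (k - j)) : ℝ≥0) : ℝ≥0∞)} ⊆
      {ω | 1 < ∑' j : ℕ, ((cS j * ((b t)⁻¹ * Z (k - j) ω) : ℝ≥0) : ℝ≥0∞)} := by
    intro ω hω
    rw [mem_ofPred_eq] at hω ⊢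
    have e : ∑' j : ℕ, ((ψ j * ((b t)⁻¹ * restr S (fun i => Z i ω) (k - j)) : ℝ≥0) : ℝ≥0∞) =
        η * ∑' j : ℕ, ((cS j * ((b t)⁻¹ * Z (k - j) ω) : ℝ≥0) : ℝ≥0∞) := by
      rw [← ENNReal.tsum_mul_left]
      refine tsum_congr fun j => ?_
      rw [← ENNReal.coe_mul]
      congr 1
      by_cases h : k - (j : ℤ) ∈ S
      · have e : restr S (fun i => Z i ω) (k - j) = Z (k - j) ω := restr_of_mem h _
        rw [e]
        simp only [hcS, h, if_true, hc]
        field_simp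
      · have e : restr S (fun i => Z i ω) (k - j) = 0 := restr_of_notMem h _
        rw [e]
        simp [hcS, h]
    rw [e] at hω
    by_contra! hcon
    have : (η : ℝ≥0∞) * ∑' j : ℕ, ((cS j * ((b t)⁻¹ * Z (k - j) ω) : ℝ≥0) : ℝ≥0∞) ≤ η * 1 := by
      gcongr
    rw [mul_one] at this
    exact absurd hω (not_lt.2 this)
  calc _ ≤ _ := mul_le_mul_right (measure_mono hset) _
    _ ≤ _ := h1
    _ = K * ∑' j : ℕ, S.indicator (fun i => (a i : ℝ≥0∞)) (k - j) := by simp_rw [hcS']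
    _ ≤ K * ∑' i, S.indicator (fun i => (a i : ℝ≥0∞)) i := by
        gcongr
        exact ENNReal.tsum_comp_le_tsum_of_injective hinj _
    _ = _ := by
        rw [← ENNReal.tsum_mul_left]
        refine tsum_congr fun i => ?_
        by_cases h : i ∈ S <;> simp [h]

/-- On the divergence event the rescaled series is `∞ > 1` whenever `b t > 0`. This event does not
depend on `t`, yet `t` times its probability stays bounded, so it is null. -/
theorem IsTailScaling.ae_summable (hmeas : ∀ i, Measurable (Z i))
    (hident : ∀ i, IdentDistrib (Z i) (Z 0) P P) (htail : RegularlyVaryingTail P (Z 0) α)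
    (hδ : 0 < δ) (hδ1 : δ < min α 1) (hψ : Summable fun j => ψ j ^ δ)
    (hb : IsTailScaling P (Z 0) α b) :
    ∀ᵐ ω ∂P, ∀ k : ℤ, Summable fun j : ℕ => ψ j * Z (k - j) ω := by
  rw [ae_all_iff]
  intro k
  obtain ⟨a, ha, h⟩ := hb.measure_coordinate_le hmeas hident htail hδ hδ1 hψ k one_pos
  have hbpos := (hb.tendsto_atTop htail.pos).eventually_gt_atTop 0
  rw [ae_iff]
  set N := {ω | ¬Summable fun j : ℕ => ψ j * Z (k - j) ω}
  have hN : ∀ᶠ t : ℝ≥0 in atTop, (t : ℝ≥0∞) * P N ≤ (∑' i, a i : ℝ≥0) := by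
    filter_upwards [h, hbpos] with t ht htb
    have h1 := ht univ
    rw [indicator_univ] at h1
    simp_rw [restr_univ (fun i => Z i _ : RZ)] at h1
    rw [ENNReal.coe_tsum ha]
    refine le_trans ?_ h1
    gcongr
    intro ω hω
    have h2 : ¬Summable fun j : ℕ => ψ j * ((b t)⁻¹ * Z (k - j) ω) := by
      intro hs
      refine hω ((hs.mul_left (b t)).congr fun j => ?_)
      field_simp
    rw [mem_ofPred_eq, ENNReal.tsum_coe_eq_top_iff_not_summable_coe.2]
    · simp
    · exact fun hs => h2 (NNReal.summable_coe.1 hs)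
  by_contra hP
  have hP0 : 0 < (P N).toReal := ENNReal.toReal_pos hP (measure_ne_top _ _)
  have h3 : Tendsto (fun t : ℝ≥0 => (t : ℝ) * (P N).toReal) atTop atTop :=
    Tendsto.atTop_mul_const hP0 (NNReal.tendsto_coe_atTop.2 tendsto_id)
  obtain ⟨t, h4, h5⟩ := (hN.and (h3.eventually_gt_atTop ((∑' i, a i : ℝ≥0) : ℝ))).exists
  have h6 := ENNReal.toReal_mono ENNReal.coe_ne_top h4
  rw [ENNReal.toReal_mul, ENNReal.coe_toReal, ENNReal.coe_toReal] at h6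
  linarith

/-- The probability that a rescaled restricted moving average is not close to zero is controlled by
a summable sequence, uniformly in the restriction. -/
theorem IsTailScaling.measure_dZ_maMap_restr_le (hmeas : ∀ i, Measurable (Z i))
    (hident : ∀ i, IdentDistrib (Z i) (Z 0) P P) (htail : RegularlyVaryingTail P (Z 0) α)
    (hδ : 0 < δ) (hδ1 : δ < min α 1) (hψ : Summable fun j => ψ j ^ δ)
    (hb : IsTailScaling P (Z 0) α b) {ε : ℝ} (hε : 0 < ε) :
    ∃ a : ℤ → ℝ≥0, Summable a ∧ ∀ᶠ t : ℝ≥0 in atTop, ∀ S : Set ℤ,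
      t * P {ω | ε ≤ dZ ((b t)⁻¹ • maMap ψ (restr S fun i => Z i ω)) 0}
        ≤ ∑' i, S.indicator (fun i => (a i : ℝ≥0∞)) i := by
  obtain ⟨F, η, hη, hF⟩ := exists_dZ_zero_lt hε
  choose a ha hat using fun k =>
    hb.measure_coordinate_le hmeas hident htail hδ hδ1 hψ k hη
  refine ⟨fun i => ∑ k ∈ F, a k i, summable_sum fun k _ => ha k, ?_⟩
  filter_upwards [(eventually_all_finset F).2 fun k _ => hat k] with t ht S
  have hsub : {ω | ε ≤ dZ ((b t)⁻¹ • maMap ψ (restr S fun i => Z i ω)) 0} ⊆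
      ⋃ k ∈ F, {ω | η < ∑' j : ℕ,
        ((ψ j * ((b t)⁻¹ * restr S (fun i => Z i ω) (k - j)) : ℝ≥0) : ℝ≥0∞)} := by
    intro ω hω
    by_contra hcon
    simp only [mem_iUnion, mem_ofPred_eq, not_exists, not_lt] at hcon
    refine absurd (hF _ fun k hk => ?_) (not_lt.2 hω)
    rw [← maMap_smul]
    have := (coe_tsum_le _).trans (hcon k hk)
    exact_mod_cast this
  calc _ ≤ t * ∑ k ∈ F, P {ω | η < ∑' j : ℕ,
        ((ψ j * ((b t)⁻¹ * restr S (fun i => Z i ω) (k - j)) : ℝ≥0) : ℝ≥0∞)} := by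
        gcongr
        exact (measure_mono hsub).trans (measure_biUnion_finset_le _ _)
    _ ≤ ∑ k ∈ F, ∑' i, S.indicator (fun i => (a k i : ℝ≥0∞)) i := by
        rw [Finset.mul_sum]
        exact Finset.sum_le_sum fun k hk => ht k hk S
    _ = _ := by
        rw [← Summable.tsum_finsetSum fun _ _ => ENNReal.summable]
        refine tsum_congr fun i => ?_
        by_cases h : i ∈ S <;> simp [h]

end

/-! ### Convergence in one dimension -/

section OneDim

/-- Approximation of the integral of a Lipschitz function by that of a step function. -/
theorem abs_integral_sub_step_le {μ : Measure ℝ≥0} {G : ℝ≥0 → ℝ} {L : ℝ≥0} {M : ℝ}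
    (hG : LipschitzWith L G) (hM : ∀ x, |G x| ≤ M) {η : ℝ≥0} (hη : ∀ x, x ≤ η → G x = 0)
    (hμ : μ (Ioi η) < ∞) (h : ℝ≥0) (n : ℕ) :
    |∫ x, G x ∂μ - ∑ j ∈ Finset.range n, G (η + j * h) *
        (μ.real (Ioi (η + j * h)) - μ.real (Ioi (η + (j + 1 : ℕ) * h)))| ≤
      L * h * μ.real (Ioi η) + M * μ.real (Ioi (η + n * h)) := by
  have hfin : ∀ x, η ≤ x → μ (Ioi x) < ∞ := fun x hx =>
    (measure_mono (Ioi_subset_Ioi hx)).trans_lt hμ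
  have hint : IntegrableOn G (Ioi η) μ := by
    refine Measure.integrableOn_of_bounded (M := M) hμ.ne hG.continuous.aestronglyMeasurable ?_
    exact ae_of_all _ fun x => hM x
  have hgrid : ∀ n : ℕ, η + n * h ≤ η + (n + 1 : ℕ) * h := fun n => by
    gcongr; omega
  have hle : ∀ n : ℕ, η ≤ η + n * h := fun n => le_self_add
  -- Induction peels off one interval `(u, v]` of length `h` at a time. On it `G` differs from `G u`
  -- by at most `L * h`, and the masses of the intervals telescope.
  have key : |∫ x, G x ∂μ - ∫ x in Ioi (η + n * h), G x ∂μ - ∑ j ∈ Finset.range n,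
      G (η + j * h) * (μ.real (Ioi (η + j * h)) - μ.real (Ioi (η + (j + 1 : ℕ) * h)))| ≤
      L * h * (μ.real (Ioi η) - μ.real (Ioi (η + n * h))) := by
    induction n with
    | zero =>
      have : ∫ x in Ioi η, G x ∂μ = ∫ x, G x ∂μ :=
        setIntegral_eq_integral_of_forall_compl_eq_zero fun x hx => hη x (not_lt.1 hx)
      simp [this]
    | succ n ih =>
      set u := η + n * h
      set v := η + (n + 1 : ℕ) * h
      have huv : u ≤ v := hgrid n
      have hu : IntegrableOn G (Ioi u) μ := hint.mono_set (Ioi_subset_Ioi (hle n))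
      have hsplit : ∫ x in Ioi u, G x ∂μ = ∫ x in Ioc u v, G x ∂μ + ∫ x in Ioi v, G x ∂μ := by
        rw [← setIntegral_union (Ioc_disjoint_Ioi le_rfl) measurableSet_Ioi
          (hu.mono_set Ioc_subset_Ioi_self) (hu.mono_set (Ioi_subset_Ioi huv)),
          Ioc_union_Ioi_eq_Ioi huv]
      have hIoc : μ.real (Ioc u v) = μ.real (Ioi u) - μ.real (Ioi v) := by
        rw [← Ioc_union_Ioi_eq_Ioi huv, measureReal_union (Ioc_disjoint_Ioi le_rfl)
          measurableSet_Ioi ((measure_mono Ioc_subset_Ioi_self).trans_lt (hfin u (hle n))).ne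
          (hfin v (hle _)).ne]
        ring
      have hIocfin : μ (Ioc u v) < ∞ := (measure_mono Ioc_subset_Ioi_self).trans_lt (hfin u (hle n))
      have hstep : |∫ x in Ioc u v, G x ∂μ - G u * (μ.real (Ioi u) - μ.real (Ioi v))| ≤
          L * h * (μ.real (Ioi u) - μ.real (Ioi v)) := by
        have e : ∫ x in Ioc u v, (G x - G u) ∂μ =
            ∫ x in Ioc u v, G x ∂μ - G u * (μ.real (Ioi u) - μ.real (Ioi v)) := by
          rw [integral_sub (hu.mono_set Ioc_subset_Ioi_self) (integrableOn_const hIocfin.ne),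
            setIntegral_const, hIoc, smul_eq_mul, mul_comm]
        rw [← e, ← hIoc]
        rw [← Real.norm_eq_abs]
        refine norm_setIntegral_le_of_norm_le_const hIocfin fun x hx => ?_
        rw [← dist_eq_norm]
        refine (hG.dist_le_mul x u).trans ?_
        gcongr
        rw [NNReal.dist_eq, abs_of_nonneg (sub_nonneg.2 (NNReal.coe_le_coe.2 hx.1.le)),
          sub_le_iff_le_add]
        have : v = h + u := by simp only [u, v]; push_cast; ring
        exact_mod_cast this ▸ hx.2
      rw [Finset.sum_range_succ]
      rw [hsplit] at ih
      have := abs_add_le (∫ x, G x ∂μ - (∫ x in Ioc u v, G x ∂μ + ∫ x in Ioi v, G x ∂μ) -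
        ∑ j ∈ Finset.range n, G (η + j * h) *
          (μ.real (Ioi (η + j * h)) - μ.real (Ioi (η + (j + 1 : ℕ) * h))))
        (∫ x in Ioc u v, G x ∂μ - G u * (μ.real (Ioi u) - μ.real (Ioi v)))
      calc _ = _ := by congr 1; ring
        _ ≤ _ := this
        _ ≤ _ := add_le_add ih hstep
        _ = _ := by ring
  have htail : |∫ x in Ioi (η + n * h), G x ∂μ| ≤ M * μ.real (Ioi (η + n * h)) := by
    rw [← Real.norm_eq_abs]
    exact norm_setIntegral_le_of_norm_le_const (hfin _ (hle n)) fun x _ => hM x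
  have h1 : L * h * (μ.real (Ioi η) - μ.real (Ioi (η + n * h))) ≤ L * h * μ.real (Ioi η) := by
    gcongr; exact sub_le_self _ measureReal_nonneg
  have h2 := abs_add_le (∫ x, G x ∂μ - ∫ x in Ioi (η + n * h), G x ∂μ - ∑ j ∈ Finset.range n,
      G (η + j * h) * (μ.real (Ioi (η + j * h)) - μ.real (Ioi (η + (j + 1 : ℕ) * h))))
      (∫ x in Ioi (η + n * h), G x ∂μ)
  calc _ = _ := by congr 1; ring
    _ ≤ _ := h2
    _ ≤ _ := add_le_add (key.trans h1) htail

/-- The step sums are finite combinations of tails, so they converge. The mesh is fixed first and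
the number of steps second, making both error terms small for `μ`; these errors are tails too, hence
remain small along `μs`. -/
theorem tendsto_integral_of_tendsto_Ioi {ι : Type*} {l : Filter ι} {μs : ι → Measure ℝ≥0}
    {μ : Measure ℝ≥0} (hfin : ∀ᶠ i in l, ∀ x, 0 < x → μs i (Ioi x) < ∞)
    (hμ : ∀ x, 0 < x → μ (Ioi x) < ∞)
    (hzero : Tendsto (fun x : ℝ≥0 => μ.real (Ioi x)) atTop (𝓝 0))
    (h : ∀ x, 0 < x → Tendsto (fun i => (μs i).real (Ioi x)) l (𝓝 (μ.real (Ioi x))))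
    {G : ℝ≥0 → ℝ} {L : ℝ≥0} {M : ℝ} (hG : LipschitzWith L G) (hM : ∀ x, |G x| ≤ M) {η : ℝ≥0}
    (hη0 : 0 < η) (hη : ∀ x, x ≤ η → G x = 0) :
    Tendsto (fun i => ∫ x, G x ∂(μs i)) l (𝓝 (∫ x, G x ∂μ)) := by
  rw [Metric.tendsto_nhds]
  intro ε hε
  obtain ⟨h', hh', hh'2⟩ : ∃ h' : ℝ≥0, 0 < h' ∧ L * h' * μ.real (Ioi η) < ε / 6 := by
    have : Tendsto (fun h' : ℝ≥0 => (L : ℝ) * h' * μ.real (Ioi η)) (𝓝[>] 0) (𝓝 0) := by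
      have : Tendsto (fun h' : ℝ≥0 => (L : ℝ) * h' * μ.real (Ioi η)) (𝓝 0)
          (𝓝 ((L : ℝ) * (0 : ℝ≥0) * μ.real (Ioi η))) := by
        refine Tendsto.mul_const _ (Tendsto.const_mul _ ?_)
        exact NNReal.continuous_coe.tendsto 0
      simpa using this.mono_left nhdsWithin_le_nhds
    obtain ⟨h', h1, h2⟩ := ((this.eventually (gt_mem_nhds (by positivity : 0 < ε / 6))).and
      self_mem_nhdsWithin).exists
    exact ⟨h', h2, h1⟩
  obtain ⟨n, hn⟩ : ∃ n : ℕ, M * μ.real (Ioi (η + n * h')) < ε / 6 := by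
    have h1 : Tendsto (fun n : ℕ => η + n * h') atTop atTop :=
      tendsto_atTop_mono (fun n => le_add_self)
        ((tendsto_natCast_atTop_atTop (R := ℝ≥0)).atTop_mul_const hh')
    have h2 := (hzero.comp h1).const_mul M
    rw [mul_zero] at h2
    exact (h2.eventually (gt_mem_nhds (by positivity : 0 < ε / 6))).exists
  have hpos : ∀ j : ℕ, 0 < η + j * h' := fun j => hη0.trans_le le_self_add
  have hsum : Tendsto (fun i => ∑ j ∈ Finset.range n, G (η + j * h') *
        ((μs i).real (Ioi (η + j * h')) - (μs i).real (Ioi (η + (j + 1 : ℕ) * h')))) l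
      (𝓝 (∑ j ∈ Finset.range n, G (η + j * h') *
        (μ.real (Ioi (η + j * h')) - μ.real (Ioi (η + (j + 1 : ℕ) * h'))))) :=
    tendsto_finsetSum _ fun j _ => ((h _ (hpos j)).sub (h _ (hpos _))).const_mul _
  have herr : Tendsto (fun i => L * h' * (μs i).real (Ioi η) + M * (μs i).real (Ioi (η + n * h'))) l
      (𝓝 (L * h' * μ.real (Ioi η) + M * μ.real (Ioi (η + n * h')))) :=
    ((h _ hη0).const_mul _).add ((h _ (hpos n)).const_mul _)
  have h0 := abs_integral_sub_step_le hG hM hη (hμ η hη0) h' n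
  filter_upwards [hfin, Metric.tendsto_nhds.1 hsum (ε / 3) (by positivity),
    herr.eventually (gt_mem_nhds (show _ < ε / 3 by linarith))] with i h1 h2 h3
  have h4 := abs_integral_sub_step_le hG hM hη (h1 η hη0) h' n
  rw [Real.dist_eq] at h2 ⊢
  rw [abs_lt] at h2 ⊢
  rw [abs_le] at h0 h4
  constructor <;> linarith

theorem nuAlpha_real_Ioi {α : ℝ} (hα : 0 < α) {x : ℝ≥0} (hx : 0 < x) :
    (nuAlpha α).real (Ioi x) = (x : ℝ) ^ (-α) := by
  rw [measureReal_def, nuAlpha_Ioi hα hx, ENNReal.toReal_ofReal (by positivity)]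

variable {Ω : Type*} [MeasurableSpace Ω] {P : Measure Ω} [IsProbabilityMeasure P] {Y : Ω → ℝ≥0}
  {α : ℝ} {b : ℝ≥0 → ℝ≥0}

theorem IsTailScaling.tendsto_integral (hα : 0 < α) (hY : Measurable Y)
    (htail : RegularlyVaryingTail P Y α) (hb : IsTailScaling P Y α b) {G : ℝ≥0 → ℝ} {L : ℝ≥0}
    {M : ℝ} (hG : LipschitzWith L G) (hM : ∀ x, |G x| ≤ M) {η : ℝ≥0}
    (hη0 : 0 < η) (hη : ∀ x, x ≤ η → G x = 0) :
    Tendsto (fun t : ℝ≥0 => (t : ℝ) * ∫ ω, G ((b t)⁻¹ * Y ω) ∂P) atTop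
      (𝓝 (∫ x, G x ∂(nuAlpha α))) := by
  have hbpos := (hb.tendsto_atTop htail.pos).eventually_gt_atTop 0
  have hm : ∀ t, Measurable fun ω => (b t)⁻¹ * Y ω := fun t => hY.const_mul _
  have hlim := tendsto_integral_of_tendsto_Ioi (l := atTop)
    (μs := fun t : ℝ≥0 => t • P.map fun ω => (b t)⁻¹ * Y ω) (μ := nuAlpha α)
    (Eventually.of_forall fun t x _ => measure_lt_top _ _)
    (fun x hx => by rw [nuAlpha_Ioi hα hx]; exact ENNReal.ofReal_lt_top)
    (by
      have h1 : Tendsto (fun x : ℝ≥0 => (x : ℝ) ^ (-α)) atTop (𝓝 0) :=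
        (tendsto_rpow_neg_atTop hα).comp (NNReal.tendsto_coe_atTop.2 tendsto_id)
      refine h1.congr' ?_
      filter_upwards [eventually_gt_atTop 0] with x hx
      rw [nuAlpha_real_Ioi hα hx])
    (fun x hx => by
      rw [nuAlpha_real_Ioi hα hx]
      refine (hb x hx).congr' ?_
      filter_upwards [hbpos] with t ht
      rw [measureReal_nnreal_smul_apply, map_measureReal_apply (hm t) measurableSet_Ioi]
      congr 2
      ext ω
      simp only [mem_preimage, mem_Ioi, mem_ofPred_eq]
      rw [inv_mul_eq_div, lt_div_iff₀ ht, mul_comm])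
    hG hM hη0 hη
  refine hlim.congr fun t => ?_
  rw [integral_smul_nnreal_measure, integral_map (hm t).aemeasurable
    hG.continuous.aestronglyMeasurable]
  rfl

end OneDim

/-! ### Lipschitz test functions -/

namespace RZ

theorem dZ_nonneg (x y : RZ) : 0 ≤ dZ x y := tsum_nonneg (term_nonneg x y)

/-- Translation invariance lets a perturbation be measured by the distance of `v` from zero, without
subtracting sequences. -/
theorem dZ_add_left (x v : RZ) : dZ (x + v) x = dZ v 0 := by
  unfold dZ
  refine tsum_congr fun i => ?_
  rw [add_apply, zero_apply]
  simp

theorem measurable_dZ_zero : Measurable fun x : RZ => dZ x 0 := by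
  simp_rw [dZ_comm _ 0]
  exact (continuous_dZ 0).measurable

/-- Nonnegative bounded Lipschitz functions vanishing near zero. -/
structure LipTest (F : RZ → ℝ) (L M r : ℝ) : Prop where
  lip_nonneg : 0 ≤ L
  pos : 0 < r
  lip : ∀ x y, |F x - F y| ≤ L * dZ x y
  nonneg : ∀ x, 0 ≤ F x
  le : ∀ x, F x ≤ M
  zero : ∀ x, dZ x 0 < r → F x = 0

/-- The indicator of the complement of the ball of radius `ε` around zero. -/
def far (ε : ℝ) : RZ → ℝ := {x | ε ≤ dZ x 0}.indicator 1

theorem far_of_le {ε : ℝ} {x : RZ} (h : ε ≤ dZ x 0) : far ε x = 1 :=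
  indicator_of_mem (s := {x | ε ≤ dZ x 0}) h _

theorem far_of_lt {ε : ℝ} {x : RZ} (h : dZ x 0 < ε) : far ε x = 0 :=
  indicator_of_notMem (s := {x | ε ≤ dZ x 0}) (not_le.2 h) _

theorem far_nonneg (ε : ℝ) (x : RZ) : 0 ≤ far ε x := by
  rcases le_or_gt ε (dZ x 0) with h | h
  · rw [far_of_le h]; exact zero_le_one
  · rw [far_of_lt h]

theorem far_le_one (ε : ℝ) (x : RZ) : far ε x ≤ 1 := by
  rcases le_or_gt ε (dZ x 0) with h | h
  · rw [far_of_le h]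
  · rw [far_of_lt h]; exact zero_le_one

theorem measurable_far (ε : ℝ) : Measurable (far ε) :=
  measurable_one.indicator (measurableSet_le measurable_const measurable_dZ_zero)

namespace LipTest

variable {F : RZ → ℝ} {L M r : ℝ}

theorem measurable (h : LipTest F L M r) : Measurable F := by
  have : LipschitzWith L.toNNReal F := LipschitzWith.of_dist_le_mul fun x y => by
    rw [Real.dist_eq, Real.coe_toNNReal _ h.lip_nonneg]; exact h.lip x y
  exact this.continuous.measurable

theorem bound_nonneg (h : LipTest F L M r) : 0 ≤ M := (h.nonneg 0).trans (h.le 0)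

theorem le_far (h : LipTest F L M r) (x : RZ) : F x ≤ M * far r x := by
  rcases le_or_gt r (dZ x 0) with h1 | h1
  · rw [far_of_le h1, mul_one]; exact h.le x
  · rw [h.zero x h1, far_of_lt h1, mul_zero]

/-- If `x` is within `r / 2` of zero, then `x + v` is within `r` and both values vanish; otherwise
the Lipschitz bound applies. The factor `far (r / 2) x` keeps the error integrable against measures
that blow up near zero. -/
theorem abs_sub_le_of_lt (h : LipTest F L M r) {ε : ℝ} (hε : ε ≤ r / 2) (x v : RZ)
    (hv : dZ v 0 < ε) : |F (x + v) - F x| ≤ L * ε * far (r / 2) x := by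
  rcases le_or_gt (r / 2) (dZ x 0) with h1 | h1
  · rw [far_of_le h1, mul_one]
    refine (h.lip _ _).trans ?_
    rw [dZ_add_left]
    exact mul_le_mul_of_nonneg_left hv.le h.lip_nonneg
  · have h2 := dZ_triangle (x + v) x 0
    rw [dZ_add_left] at h2
    rw [h.zero (x + v) (by linarith), h.zero x (by linarith [h.pos]), far_of_lt h1]
    simp

theorem abs_sub_le (h : LipTest F L M r) {ε : ℝ} (hε0 : 0 < ε) (hε : ε ≤ r / 2) (x v : RZ) :
    |F (x + v) - F x| ≤ M * far ε v + L * ε * far (r / 2) x := by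
  have h3 : 0 ≤ L * ε * far (r / 2) x :=
    mul_nonneg (mul_nonneg h.lip_nonneg hε0.le) (far_nonneg _ _)
  rcases le_or_gt ε (dZ v 0) with h1 | h1
  · rw [far_of_le h1, mul_one]
    have : |F (x + v) - F x| ≤ M := by
      rw [abs_le]
      constructor <;> linarith [h.nonneg x, h.nonneg (x + v), h.le x, h.le (x + v)]
    linarith
  · rw [far_of_lt h1, mul_zero, zero_add]
    exact h.abs_sub_le_of_lt hε x v h1

/-- The single-jump principle: if one of `x`, `v` is within `ε` of zero, its own value vanishes and
it only perturbs the other. The crude bound `2 * M` is paid only when both are far. -/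
theorem abs_sub_sub_le (h : LipTest F L M r) {ε : ℝ} (hε0 : 0 < ε) (hε : ε ≤ r / 2) (x v : RZ) :
    |F (x + v) - F x - F v| ≤
      2 * M * (far ε x * far ε v) + L * ε * (far (r / 2) x + far (r / 2) v) := by
  have h3 : 0 ≤ L * ε * far (r / 2) x :=
    mul_nonneg (mul_nonneg h.lip_nonneg hε0.le) (far_nonneg _ _)
  have h4 : 0 ≤ L * ε * far (r / 2) v :=
    mul_nonneg (mul_nonneg h.lip_nonneg hε0.le) (far_nonneg _ _)
  have h5 := h.pos
  rcases le_or_gt ε (dZ v 0) with h1 | h1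
  · rcases le_or_gt ε (dZ x 0) with h2 | h2
    · rw [far_of_le h1, far_of_le h2, mul_one, mul_one]
      have : |F (x + v) - F x - F v| ≤ 2 * M := by
        rw [abs_le]
        constructor <;>
          linarith [h.nonneg x, h.nonneg (x + v), h.le x, h.le (x + v), h.nonneg v, h.le v]
      linarith
    · rw [h.zero x (by linarith), far_of_lt h2, sub_zero, add_comm x v]
      have := h.abs_sub_le_of_lt hε v x h2
      linarith
  · rw [h.zero v (by linarith), far_of_lt h1, sub_zero]
    have := h.abs_sub_le_of_lt hε x v h1
    linarith

end LipTest

/-! ### One large innovation -/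

theorem single_eq_smul (i : ℤ) (z : ℝ≥0) : single i z = z • single i 1 := by
  funext k
  rw [smul_apply]
  by_cases h : k = i
  · rw [h, single_same, single_same, mul_one]
  · rw [single_of_ne h, single_of_ne h, mul_zero]

theorem maMap_single (ψ : ℕ → ℝ≥0) (i : ℤ) (z : ℝ≥0) :
    maMap ψ (single i z) = z • maMap ψ (single i 1) := by
  rw [single_eq_smul, maMap_smul]

theorem maMap_single_apply_le {ψ : ℕ → ℝ≥0} {B : ℝ≥0} (hB : ∀ j, ψ j ≤ B) (i k : ℤ) :
    maMap ψ (single i 1) k ≤ B := by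
  unfold maMap
  -- Only `j = k - i` can contribute. For `k < i`, `toNat` returns `0` and that term vanishes as
  -- well.
  rw [tsum_eq_single (k - i).toNat]
  · have : single i 1 (k - ((k - i).toNat : ℤ)) ≤ 1 := by
      by_cases h : k - ((k - i).toNat : ℤ) = i
      · rw [h, single_same]
      · rw [single_of_ne h]; exact zero_le_one
    calc _ ≤ B * 1 := by gcongr; exact hB _
      _ = B := mul_one B
  · intro j hj
    rw [single_of_ne, mul_zero]
    intro h
    apply hj
    omega

/-- Makes `z ↦ T^∞(z e_i)` Lipschitz, so that a Lipschitz test function on sequences becomes one on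
`ℝ≥0`. -/
theorem dZ_smul_le {u : RZ} {B : ℝ≥0} (hu : ∀ k, u k ≤ B) (z z' : ℝ≥0) :
    dZ (z • u) (z' • u) ≤ (B * ∑' i : ℤ, (1 : ℝ) / 2 ^ (i.natAbs + 1)) * dist z z' := by
  unfold dZ
  rw [← tsum_mul_left, ← tsum_mul_right]
  refine (summable_term _ _).tsum_le_tsum (fun i => ?_)
    ((summable_weight.mul_left _).mul_right _)
  rw [smul_apply, smul_apply, NNReal.coe_mul, NNReal.coe_mul, ← sub_mul, abs_mul,
    abs_of_nonneg (u i).coe_nonneg, NNReal.dist_eq, mul_one_div, div_mul_eq_mul_div,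
    mul_comm (B : ℝ)]
  gcongr
  exact (min_le_left _ _).trans (by gcongr; exact hu i)

theorem LipTest.exists_single_eq_zero {F : RZ → ℝ} {L M r : ℝ} (hF : LipTest F L M r)
    {ψ : ℕ → ℝ≥0} {B : ℝ≥0} (hB : ∀ j, ψ j ≤ B) (i : ℤ) :
    ∃ η : ℝ≥0, 0 < η ∧ ∀ z, z ≤ η → F (maMap ψ (single i z)) = 0 := by
  set u := maMap ψ (single i 1)
  have hu : ∀ k, u k ≤ B := maMap_single_apply_le hB i
  set D : ℝ := B * ∑' i : ℤ, (1 : ℝ) / 2 ^ (i.natAbs + 1)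
  have hD : 0 ≤ D := mul_nonneg B.coe_nonneg (tsum_nonneg fun i => by positivity)
  have hr := hF.pos
  refine ⟨(r / (2 * (D + 1))).toNNReal, Real.toNNReal_pos.2 (by positivity), fun z hz => ?_⟩
  apply hF.zero
  rw [maMap_single]
  have h0 : (0 : ℝ≥0) • u = 0 := by funext k; rw [smul_apply, zero_mul, zero_apply]
  have h2 := dZ_smul_le hu z 0
  rw [h0, NNReal.dist_eq, NNReal.coe_zero, sub_zero, abs_of_nonneg z.coe_nonneg] at h2
  refine h2.trans_lt ?_
  have h3 := NNReal.coe_le_coe.2 hz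
  rw [Real.coe_toNNReal _ (by positivity), le_div_iff₀ (by positivity)] at h3
  change D * z < r
  have : 0 ≤ (z : ℝ) := z.coe_nonneg
  nlinarith

end RZ

/-! ### Moving averages over blocks of innovations -/

section

variable {Ω : Type*} [MeasurableSpace Ω] {P : Measure Ω} [IsProbabilityMeasure P]
  {Z : ℤ → Ω → ℝ≥0} {α δ : ℝ} {ψ : ℕ → ℝ≥0} {b : ℝ≥0 → ℝ≥0}

/-- The sequence of innovations at `ω`. -/
def seqAt (Z : ℤ → Ω → ℝ≥0) (ω : Ω) : RZ := fun i => Z i ω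

/-- The moving average of the innovations with index in `S`, multiplied by `c⁻¹`. -/
def scaledMA (ψ : ℕ → ℝ≥0) (Z : ℤ → Ω → ℝ≥0) (c : ℝ≥0) (S : Set ℤ) (ω : Ω) : RZ :=
  c⁻¹ • maMap ψ (restr S (seqAt Z ω))

theorem measurable_scaledMA (hmeas : ∀ i, Measurable (Z i)) (c : ℝ≥0) (S : Set ℤ) :
    Measurable (scaledMA ψ Z c S) :=
  (measurable_const_smul _).comp ((measurable_maMap ψ).comp ((measurable_restr S).comp
    (measurable_iff.2 hmeas)))

omit [MeasurableSpace Ω] in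
theorem scaledMA_singleton (c : ℝ≥0) (i : ℤ) (ω : Ω) :
    scaledMA ψ Z c {i} ω = maMap ψ (single i (c⁻¹ * Z i ω)) := by
  rw [scaledMA, restr_singleton, maMap_single, maMap_single _ _ (_ * _)]
  funext k
  simp only [smul_apply, mul_assoc, seqAt]

omit [MeasurableSpace Ω] in
theorem scaledMA_union {c : ℝ≥0} {S T : Set ℤ} (h : Disjoint S T) {ω : Ω}
    (hω : ∀ k : ℤ, Summable fun j : ℕ => ψ j * Z (k - j) ω) :
    scaledMA ψ Z c (S ∪ T) ω = scaledMA ψ Z c S ω + scaledMA ψ Z c T ω := by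
  have hs : ∀ (S : Set ℤ) (k : ℤ), Summable fun j : ℕ => ψ j * restr S (seqAt Z ω) (k - j) :=
    fun S k => NNReal.summable_of_le (fun j => by gcongr; exact restr_le S _ _) (hω k)
  rw [scaledMA, restr_union h, maMap_add ψ (hs S) (hs T)]
  funext k
  simp only [scaledMA, add_apply, smul_apply, mul_add]

omit [IsProbabilityMeasure P] in
-- For finite `s` the moving average is a measurable function of the vector `(Z i)` with `i ∈ s`,
-- and disjoint blocks of independent variables are independent.
theorem indepFun_scaledMA (hmeas : ∀ i, Measurable (Z i)) (hindep : iIndepFun Z P) (c : ℝ≥0)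
    {s t : Finset ℤ} (hst : Disjoint s t) :
    IndepFun (scaledMA ψ Z c s) (scaledMA ψ Z c t) P := by
  classical
  have key : ∀ s : Finset ℤ, ∃ g : (s → ℝ≥0) → RZ, Measurable g ∧
      scaledMA ψ Z c s = g ∘ fun ω (i : s) => Z i ω := by
    intro s
    refine ⟨fun x => c⁻¹ • maMap ψ fun k => if h : k ∈ s then x ⟨k, h⟩ else 0, ?_, ?_⟩
    · refine (measurable_const_smul _).comp ((measurable_maMap ψ).comp (measurable_iff.2 fun k => ?_))
      by_cases h : k ∈ s
      · simpa only [h, dif_pos] using measurable_pi_apply _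
      · simp only [h, dif_neg, not_false_eq_true]; exact measurable_const
    · funext ω
      have : restr (↑s) (seqAt Z ω) = fun k => if h : k ∈ s then Z k ω else 0 := by
        funext k
        by_cases h : k ∈ s
        · rw [restr_of_mem (Finset.mem_coe.2 h), dif_pos h]; rfl
        · rw [restr_of_notMem (fun h' => h (Finset.mem_coe.1 h')), dif_neg h]
      simp only [scaledMA, this, Function.comp_apply]
  obtain ⟨g, hg, hg'⟩ := key s
  obtain ⟨g', hgt, hgt'⟩ := key t
  rw [hg', hgt']
  exact (hindep.indepFun_finset s t hst hmeas).comp hg hgt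

/-- The contribution of a single innovation. -/
theorem IsTailScaling.tendsto_integral_scaledMA_singleton (hα : 0 < α)
    (hmeas : ∀ i, Measurable (Z i)) (hident : ∀ i, IdentDistrib (Z i) (Z 0) P P)
    (htail : RegularlyVaryingTail P (Z 0) α) {B : ℝ≥0} (hB : ∀ j, ψ j ≤ B)
    (hb : IsTailScaling P (Z 0) α b) {F : RZ → ℝ} {L M r : ℝ} (hF : LipTest F L M r) (i : ℤ) :
    Tendsto (fun t : ℝ≥0 => (t : ℝ) * ∫ ω, F (scaledMA ψ Z (b t) {i} ω) ∂P) atTop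
      (𝓝 (∫ z, F (maMap ψ (single i z)) ∂(nuAlpha α))) := by
  set u := maMap ψ (single i 1)
  have hu : ∀ k, u k ≤ B := maMap_single_apply_le hB i
  set D : ℝ := B * ∑' i : ℤ, (1 : ℝ) / 2 ^ (i.natAbs + 1)
  have hD : 0 ≤ D := mul_nonneg B.coe_nonneg (tsum_nonneg fun i => by positivity)
  have hG : LipschitzWith (L * D).toNNReal fun z => F (maMap ψ (single i z)) := by
    refine LipschitzWith.of_dist_le_mul fun z z' => ?_
    rw [Real.coe_toNNReal _ (mul_nonneg hF.lip_nonneg hD), maMap_single, maMap_single _ _ z',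
      Real.dist_eq, mul_assoc]
    exact (hF.lip _ _).trans (mul_le_mul_of_nonneg_left (dZ_smul_le hu z z') hF.lip_nonneg)
  obtain ⟨η, hη0, hη⟩ := hF.exists_single_eq_zero hB i
  have h1 := hb.tendsto_integral hα (hmeas 0) htail hG
    (M := M) (fun z => by rw [abs_of_nonneg (hF.nonneg _)]; exact hF.le _) hη0 hη
  refine h1.congr fun t => ?_
  simp_rw [scaledMA_singleton]
  have hm : Measurable fun y : ℝ≥0 => F (maMap ψ (single i ((b t)⁻¹ * y))) :=
    hG.continuous.measurable.comp (measurable_id.const_mul _)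
  congr 1
  exact ((hident i).comp hm).integral_eq.symm

omit [IsProbabilityMeasure P] in
theorem integral_far (hmeas : ∀ i, Measurable (Z i)) (c : ℝ≥0) (S : Set ℤ) (ε : ℝ) :
    ∫ ω, far ε (scaledMA ψ Z c S ω) ∂P = P.real {ω | ε ≤ dZ (scaledMA ψ Z c S ω) 0} := by
  have hm : MeasurableSet {ω | ε ≤ dZ (scaledMA ψ Z c S ω) 0} :=
    measurableSet_le measurable_const (measurable_dZ_zero.comp (measurable_scaledMA hmeas c S))
  rw [← integral_indicator_one hm]
  rfl

theorem integrable_far (hmeas : ∀ i, Measurable (Z i)) (c : ℝ≥0) (S : Set ℤ) (ε : ℝ) :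
    Integrable (fun ω => far ε (scaledMA ψ Z c S ω)) P := by
  refine Integrable.of_bound (C := 1)
    ((measurable_far ε).comp (measurable_scaledMA hmeas c S)).aestronglyMeasurable
    (ae_of_all _ fun ω => ?_)
  rw [Real.norm_of_nonneg (far_nonneg _ _)]
  exact far_le_one _ _

theorem RZ.LipTest.integrable {F : RZ → ℝ} {L M r : ℝ} (hF : LipTest F L M r)
    (hmeas : ∀ i, Measurable (Z i)) (c : ℝ≥0) (S : Set ℤ) :
    Integrable (fun ω => F (scaledMA ψ Z c S ω)) P := by
  refine Integrable.of_bound (C := M)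
    (hF.measurable.comp (measurable_scaledMA hmeas c S)).aestronglyMeasurable
    (ae_of_all _ fun ω => ?_)
  rw [Real.norm_of_nonneg (hF.nonneg _)]
  exact hF.le _

/-- A tightness property of the moving averages, uniform in the set of innovations. -/
def UniformTail (P : Measure Ω) (ψ : ℕ → ℝ≥0) (Z : ℤ → Ω → ℝ≥0) (b : ℝ≥0 → ℝ≥0) : Prop :=
  ∀ ε : ℝ, 0 < ε → ∃ a : ℤ → ℝ, (∀ i, 0 ≤ a i) ∧ Summable a ∧ ∀ᶠ t : ℝ≥0 in atTop, ∀ S : Set ℤ,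
    (t : ℝ) * P.real {ω | ε ≤ dZ (scaledMA ψ Z (b t) S ω) 0} ≤ ∑' i, S.indicator a i

theorem IsTailScaling.uniformTail (hmeas : ∀ i, Measurable (Z i))
    (hident : ∀ i, IdentDistrib (Z i) (Z 0) P P) (htail : RegularlyVaryingTail P (Z 0) α)
    (hδ : 0 < δ) (hδ1 : δ < min α 1) (hψ : Summable fun j => ψ j ^ δ)
    (hb : IsTailScaling P (Z 0) α b) : UniformTail P ψ Z b := by
  intro ε hε
  obtain ⟨a, ha, h⟩ := hb.measure_dZ_maMap_restr_le hmeas hident htail hδ hδ1 hψ hε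
  refine ⟨fun i => a i, fun i => (a i).coe_nonneg, NNReal.summable_coe.2 ha, ?_⟩
  filter_upwards [h] with t ht S
  have e : ∀ i, S.indicator (fun i => (a i : ℝ≥0∞)) i = ((S.indicator a i : ℝ≥0) : ℝ≥0∞) := by
    intro i
    by_cases h : i ∈ S
    · rw [indicator_of_mem h, indicator_of_mem h]
    · rw [indicator_of_notMem h, indicator_of_notMem h]; rfl
  have e' : ∀ i, S.indicator (fun i => (a i : ℝ)) i = ((S.indicator a i : ℝ≥0) : ℝ) := by
    intro i
    by_cases h : i ∈ S
    · rw [indicator_of_mem h, indicator_of_mem h]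
    · rw [indicator_of_notMem h, indicator_of_notMem h]; rfl
  have h1 : (t : ℝ≥0∞) * P {ω | ε ≤ dZ (scaledMA ψ Z (b t) S ω) 0} ≤
    ∑' i, S.indicator (fun i => (a i : ℝ≥0∞)) i := ht S
  have hs : Summable (S.indicator a) :=
    NNReal.summable_of_le (indicator_le_self S a) ha
  simp_rw [e] at h1
  rw [← ENNReal.coe_tsum hs] at h1
  have h2 := ENNReal.toReal_mono ENNReal.coe_ne_top h1
  rw [ENNReal.toReal_mul, ENNReal.coe_toReal, ENNReal.coe_toReal, NNReal.coe_tsum] at h2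
  rw [measureReal_def]
  exact h2.trans_eq (tsum_congr fun i => (e' i).symm)

end

/-! ### Convergence against Lipschitz test functions -/

section

variable {Ω : Type*} [MeasurableSpace Ω] {P : Measure Ω} [IsProbabilityMeasure P]
  {Z : ℤ → Ω → ℝ≥0} {ψ : ℕ → ℝ≥0} {b : ℝ≥0 → ℝ≥0} {F : RZ → ℝ} {L M r : ℝ}

omit [IsProbabilityMeasure P] in
theorem UniformTail.exists_bound (h : UniformTail P ψ Z b) {ε : ℝ} (hε : 0 < ε) :
    ∃ C : ℝ, 0 ≤ C ∧ ∀ᶠ t : ℝ≥0 in atTop, ∀ S : Set ℤ,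
      (t : ℝ) * P.real {ω | ε ≤ dZ (scaledMA ψ Z (b t) S ω) 0} ≤ C := by
  obtain ⟨a, ha0, ha, h⟩ := h ε hε
  refine ⟨∑' i, a i, tsum_nonneg ha0, ?_⟩
  filter_upwards [h] with t ht S
  refine (ht S).trans ((ha.indicator S).tsum_le_tsum (fun i => ?_) ha)
  exact indicator_le_self' (fun i _ => ha0 i) i

/-- The expectation of `abs_sub_sub_le`; independence factors the probability that both parts are
far from zero. -/
theorem RZ.LipTest.abs_integral_sub_sub_le (hF : LipTest F L M r) (hmeas : ∀ i, Measurable (Z i))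
    (hindep : iIndepFun Z P)
    (hsum : ∀ᵐ ω ∂P, ∀ k : ℤ, Summable fun j : ℕ => ψ j * Z (k - j) ω) {ε : ℝ} (hε0 : 0 < ε)
    (hε : ε ≤ r / 2) (c : ℝ≥0) {s : Finset ℤ} {i : ℤ} (hi : i ∉ s) :
    |∫ ω, F (scaledMA ψ Z c (s ∪ {i}) ω) ∂P - ∫ ω, F (scaledMA ψ Z c s ω) ∂P -
        ∫ ω, F (scaledMA ψ Z c {i} ω) ∂P| ≤
      2 * M * (P.real {ω | ε ≤ dZ (scaledMA ψ Z c s ω) 0} *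
        P.real {ω | ε ≤ dZ (scaledMA ψ Z c {i} ω) 0}) +
      L * ε * (P.real {ω | r / 2 ≤ dZ (scaledMA ψ Z c s ω) 0} +
        P.real {ω | r / 2 ≤ dZ (scaledMA ψ Z c {i} ω) 0}) := by
  have hind : IndepFun (scaledMA ψ Z c s) (scaledMA ψ Z c {i}) P := by
    have := indepFun_scaledMA (ψ := ψ) hmeas hindep c (Finset.disjoint_singleton_right.2 hi)
    rwa [Finset.coe_singleton] at this
  have hind' := hind.comp (measurable_far ε) (measurable_far ε)
  have hprod := hind'.integral_mul_eq_mul_integral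
    ((measurable_far ε).comp (measurable_scaledMA hmeas c s)).aestronglyMeasurable
    ((measurable_far ε).comp (measurable_scaledMA hmeas c {i})).aestronglyMeasurable
  have hint := hind'.integrable_mul (integrable_far hmeas c s ε) (integrable_far hmeas c {i} ε)
  simp only [Pi.mul_def, Function.comp_apply] at hprod hint
  have hsub : Integrable (fun ω => F (scaledMA ψ Z c (s ∪ {i}) ω) - F (scaledMA ψ Z c s ω)) P :=
    (hF.integrable hmeas c _).sub (hF.integrable hmeas c _)
  have hadd : Integrable (fun ω => L * ε * (far (r / 2) (scaledMA ψ Z c s ω) +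
      far (r / 2) (scaledMA ψ Z c {i} ω))) P :=
    ((integrable_far hmeas c _ _).add (integrable_far hmeas c _ _)).const_mul _
  rw [← integral_sub (hF.integrable hmeas c _) (hF.integrable hmeas c _),
    ← integral_sub hsub (hF.integrable hmeas c _)]
  refine abs_integral_le_integral_abs.trans ?_
  simp_rw [← integral_far hmeas]
  rw [← hprod, ← integral_const_mul, ← integral_add (integrable_far hmeas c _ _)
    (integrable_far hmeas c _ _), ← integral_const_mul, ← integral_add (hint.const_mul _) hadd]
  refine integral_mono_ae (hsub.sub (hF.integrable hmeas c _)).abs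
    ((hint.const_mul _).add hadd) ?_
  filter_upwards [hsum] with ω hω
  have hd : Disjoint (s : Set ℤ) {i} := by simpa using hi
  rw [scaledMA_union hd hω]
  exact hF.abs_sub_sub_le hε0 hε _ _

/-- The expectation of `abs_sub_le`, with the innovations outside `S` as the perturbation. -/
theorem RZ.LipTest.abs_integral_sub_le (hF : LipTest F L M r) (hmeas : ∀ i, Measurable (Z i))
    (hsum : ∀ᵐ ω ∂P, ∀ k : ℤ, Summable fun j : ℕ => ψ j * Z (k - j) ω) {ε : ℝ} (hε0 : 0 < ε)
    (hε : ε ≤ r / 2) (c : ℝ≥0) (S : Set ℤ) :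
    |∫ ω, F (scaledMA ψ Z c univ ω) ∂P - ∫ ω, F (scaledMA ψ Z c S ω) ∂P| ≤
      M * P.real {ω | ε ≤ dZ (scaledMA ψ Z c Sᶜ ω) 0} +
      L * ε * P.real {ω | r / 2 ≤ dZ (scaledMA ψ Z c S ω) 0} := by
  rw [← integral_sub (hF.integrable hmeas c _) (hF.integrable hmeas c _)]
  refine abs_integral_le_integral_abs.trans ?_
  simp_rw [← integral_far hmeas]
  rw [← integral_const_mul, ← integral_const_mul, ← integral_add
    ((integrable_far hmeas c _ _).const_mul _) ((integrable_far hmeas c _ _).const_mul _)]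
  refine integral_mono_ae ((hF.integrable hmeas c _).sub (hF.integrable hmeas c _)).abs
    (((integrable_far hmeas c _ _).const_mul _).add ((integrable_far hmeas c _ _).const_mul _)) ?_
  filter_upwards [hsum] with ω hω
  rw [← union_compl_self S, scaledMA_union disjoint_compl_right hω]
  exact hF.abs_sub_le hε0 hε _ _

omit [MeasurableSpace Ω] in
theorem scaledMA_empty (c : ℝ≥0) (ω : Ω) : scaledMA ψ Z c ∅ ω = 0 := by
  rw [scaledMA, restr_empty, maMap_zero]
  funext k
  rw [smul_apply, zero_apply, mul_zero]

variable {ℓ : ℤ → ℝ}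

theorem RZ.LipTest.exists_small (hF : LipTest F L M r) {C e : ℝ} (hC : 0 ≤ C) (he : 0 < e) :
    ∃ ε, 0 < ε ∧ ε ≤ r / 2 ∧ L * ε * C < e := by
  have hL := hF.lip_nonneg
  have hr := hF.pos
  refine ⟨min (r / 2) (e / (L * C + 1)), by positivity, min_le_left _ _, ?_⟩
  have h1 : 0 ≤ L * C := by positivity
  calc L * min (r / 2) (e / (L * C + 1)) * C = (L * C) * min (r / 2) (e / (L * C + 1)) := by ring
    _ ≤ L * C * (e / (L * C + 1)) := by gcongr; exact min_le_right _ _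
    _ < e := by
      rw [mul_div_assoc', div_lt_iff₀ (by positivity)]
      nlinarith

theorem RZ.LipTest.tendsto_finset (hF : LipTest F L M r) (hmeas : ∀ i, Measurable (Z i))
    (hindep : iIndepFun Z P)
    (hsum : ∀ᵐ ω ∂P, ∀ k : ℤ, Summable fun j : ℕ => ψ j * Z (k - j) ω)
    (hT : UniformTail P ψ Z b)
    (hℓ : ∀ i, Tendsto (fun t : ℝ≥0 => (t : ℝ) * ∫ ω, F (scaledMA ψ Z (b t) {i} ω) ∂P) atTop
      (𝓝 (ℓ i))) (s : Finset ℤ) :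
    Tendsto (fun t : ℝ≥0 => (t : ℝ) * ∫ ω, F (scaledMA ψ Z (b t) s ω) ∂P) atTop
      (𝓝 (∑ i ∈ s, ℓ i)) := by
  classical
  have hr := hF.pos
  have hM := hF.bound_nonneg
  induction s using Finset.induction_on with
  | empty =>
    have h0 : F 0 = 0 := hF.zero 0 (by rw [dZ_self]; exact hr)
    simp [scaledMA_empty, h0]
  | insert i s hi ih =>
    rw [Finset.sum_insert hi, add_comm]
    set D : ℝ≥0 → ℝ := fun t => t * (∫ ω, F (scaledMA ψ Z (b t) (s ∪ {i}) ω) ∂P -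
      ∫ ω, F (scaledMA ψ Z (b t) s ω) ∂P - ∫ ω, F (scaledMA ψ Z (b t) {i} ω) ∂P) with hD
    have hD0 : Tendsto D atTop (𝓝 0) := by
      rw [Metric.tendsto_nhds]
      intro e he
      -- The constant `C` belongs to the fixed radius `r / 2` and determines `ε`; only then is `C'`,
      -- which depends on `ε`, available.
      obtain ⟨C, hC, hCt⟩ := hT.exists_bound (half_pos hr)
      obtain ⟨ε, hε0, hε, hεe⟩ := hF.exists_small (add_nonneg hC hC) (half_pos he)
      obtain ⟨C', hC', hCt'⟩ := hT.exists_bound hε0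
      have hinv : Tendsto (fun t : ℝ≥0 => 2 * M * (C' * C') / (t : ℝ)) atTop (𝓝 0) :=
        Tendsto.const_div_atTop (NNReal.tendsto_coe_atTop.2 tendsto_id) _
      filter_upwards [hCt, hCt', hinv.eventually (gt_mem_nhds (half_pos he)),
        eventually_gt_atTop 0] with t h1 h2 h3 h4
      have h4' : (0 : ℝ) < t := h4
      rw [Real.dist_eq, sub_zero, hD, abs_mul, abs_of_pos h4']
      have h5 := hF.abs_integral_sub_sub_le hmeas hindep hsum hε0 hε (b t) hi
      set p₁ := P.real {ω | ε ≤ dZ (scaledMA ψ Z (b t) s ω) 0}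
      set p₂ := P.real {ω | ε ≤ dZ (scaledMA ψ Z (b t) {i} ω) 0}
      set q₁ := P.real {ω | r / 2 ≤ dZ (scaledMA ψ Z (b t) s ω) 0}
      set q₂ := P.real {ω | r / 2 ≤ dZ (scaledMA ψ Z (b t) {i} ω) 0}
      have hp₁ : 0 ≤ (t : ℝ) * p₁ := mul_nonneg h4'.le measureReal_nonneg
      have hp₂ : 0 ≤ (t : ℝ) * p₂ := mul_nonneg h4'.le measureReal_nonneg
      have hL := hF.lip_nonneg
      calc _ ≤ (t : ℝ) * (2 * M * (p₁ * p₂) + L * ε * (q₁ + q₂)) :=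
            mul_le_mul_of_nonneg_left h5 h4'.le
        -- Each far probability absorbs one factor `t`, so the product term is bounded by a constant
        -- over `t`.
        _ = 2 * M * ((t * p₁) * (t * p₂)) / t + L * ε * (t * q₁ + t * q₂) := by
            field_simp
        _ ≤ 2 * M * (C' * C') / t + L * ε * (C + C) := by
            gcongr
            · exact h2 _
            · exact h2 _
            · exact h1 _
            · exact h1 _
        _ < e := by linarith
    have := (hD0.add (ih.add (hℓ i)))
    rw [zero_add] at this
    refine this.congr fun t => ?_
    rw [Finset.coe_insert, insert_eq, union_comm, hD]
    ring

/-- `F ≤ M * far r` and the tail bound is uniform in the set of innovations, so the limits for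
finite sets have a common bound. This yields summability of `ℓ`. -/
theorem RZ.LipTest.sum_le (hF : LipTest F L M r) (hmeas : ∀ i, Measurable (Z i))
    (hℓs : ∀ s : Finset ℤ, Tendsto (fun t : ℝ≥0 => (t : ℝ) *
      ∫ ω, F (scaledMA ψ Z (b t) s ω) ∂P) atTop (𝓝 (∑ i ∈ s, ℓ i)))
    (hT : UniformTail P ψ Z b) : ∃ C, ∀ s : Finset ℤ, ∑ i ∈ s, ℓ i ≤ C := by
  obtain ⟨C, hC, h⟩ := hT.exists_bound hF.pos
  refine ⟨M * C, fun s => le_of_tendsto (hℓs s) ?_⟩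
  filter_upwards [h] with t ht
  have h1 : ∫ ω, F (scaledMA ψ Z (b t) s ω) ∂P ≤
      M * P.real {ω | r ≤ dZ (scaledMA ψ Z (b t) s ω) 0} := by
    rw [← integral_far hmeas, ← integral_const_mul]
    exact integral_mono (hF.integrable hmeas _ _) ((integrable_far hmeas _ _ _).const_mul _)
      fun ω => hF.le_far _
  calc _ ≤ (t : ℝ) * (M * P.real {ω | r ≤ dZ (scaledMA ψ Z (b t) s ω) 0}) := by gcongr
    _ = M * (t * P.real {ω | r ≤ dZ (scaledMA ψ Z (b t) s ω) 0}) := by ring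
    _ ≤ M * C := mul_le_mul_of_nonneg_left (ht _) hF.bound_nonneg

/-- Convergence of the rescaled moving averages against Lipschitz test functions. -/
theorem RZ.LipTest.tendsto_tsum (hF : LipTest F L M r) (hmeas : ∀ i, Measurable (Z i))
    (hindep : iIndepFun Z P)
    (hsum : ∀ᵐ ω ∂P, ∀ k : ℤ, Summable fun j : ℕ => ψ j * Z (k - j) ω)
    (hT : UniformTail P ψ Z b) (hℓ0 : ∀ i, 0 ≤ ℓ i)
    (hℓ : ∀ i, Tendsto (fun t : ℝ≥0 => (t : ℝ) * ∫ ω, F (scaledMA ψ Z (b t) {i} ω) ∂P) atTop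
      (𝓝 (ℓ i))) :
    Summable ℓ ∧ Tendsto (fun t : ℝ≥0 => (t : ℝ) * ∫ ω, F (scaledMA ψ Z (b t) univ ω) ∂P) atTop
      (𝓝 (∑' i, ℓ i)) := by
  have hfin := hF.tendsto_finset hmeas hindep hsum hT hℓ
  obtain ⟨K, hK⟩ := hF.sum_le hmeas hfin hT
  have hs : Summable ℓ := summable_of_sum_le hℓ0 hK
  refine ⟨hs, ?_⟩
  have hL := hF.lip_nonneg
  have hM := hF.bound_nonneg
  rw [Metric.tendsto_nhds]
  intro e he
  obtain ⟨C, hC, hCt⟩ := hT.exists_bound (half_pos hF.pos)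
  -- The dominating sequence `a` depends on `ε`, so `ε` must precede the finite set `s` outside
  -- which `a` is small.
  obtain ⟨ε, hε0, hε, hεe⟩ := hF.exists_small hC (show 0 < e / 6 by positivity)
  obtain ⟨a, ha0, ha, hat⟩ := hT ε hε0
  have h1 : Tendsto (fun s : Finset ℤ => M * ∑' i : {i // i ∉ s}, a i) atTop (𝓝 0) := by
    simpa using (tendsto_tsum_compl_atTop_zero a).const_mul M
  obtain ⟨s, hs1, hs2⟩ := ((h1.eventually (gt_mem_nhds (show 0 < e / 6 by positivity))).and
    (Metric.tendsto_nhds.1 hs.hasSum (e / 3) (by positivity))).exists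
  filter_upwards [hCt, hat, Metric.tendsto_nhds.1 (hfin s) (e / 3) (by positivity)]
    with t h2 h3 h4
  have h5 := hF.abs_integral_sub_le hmeas hsum hε0 hε (b t) s
  have h6 : ∑' i, ((s : Set ℤ)ᶜ).indicator a i = ∑' i : {i // i ∉ s}, a i :=
    (tsum_subtype ((s : Set ℤ)ᶜ) a).symm
  have h7 : |(t : ℝ) * ∫ ω, F (scaledMA ψ Z (b t) univ ω) ∂P -
      t * ∫ ω, F (scaledMA ψ Z (b t) s ω) ∂P| ≤ M * ∑' i : {i // i ∉ s}, a i + L * ε * C := by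
    rw [← mul_sub, abs_mul, abs_of_nonneg t.coe_nonneg]
    have h8 := h3 (s : Set ℤ)ᶜ
    rw [h6] at h8
    calc _ ≤ (t : ℝ) * (M * P.real {ω | ε ≤ dZ (scaledMA ψ Z (b t) (s : Set ℤ)ᶜ ω) 0} +
          L * ε * P.real {ω | r / 2 ≤ dZ (scaledMA ψ Z (b t) s ω) 0}) := by gcongr
      _ = M * (t * P.real {ω | ε ≤ dZ (scaledMA ψ Z (b t) (s : Set ℤ)ᶜ ω) 0}) +
          L * ε * (t * P.real {ω | r / 2 ≤ dZ (scaledMA ψ Z (b t) s ω) 0}) := by ring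
      _ ≤ _ := by
        gcongr
        exact h2 _
  rw [Real.dist_eq] at hs2 h4 ⊢
  rw [abs_lt] at hs2 h4 ⊢
  rw [abs_le] at h7
  constructor <;> linarith

end

/-! ### Existence of a scaling function -/

section

variable {Ω : Type*} [MeasurableSpace Ω] {P : Measure Ω} [IsProbabilityMeasure P] {Y : Ω → ℝ≥0}
  {α : ℝ}

theorem tendsto_tail_atTop (hY : Measurable Y) :
    Tendsto (fun x : ℝ≥0 => P.real {ω | x < Y ω}) atTop (𝓝 0) := by
  have h := tendsto_measure_iInter_atTop (μ := P) (s := fun x : ℝ≥0 => {ω | x < Y ω})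
    (fun x => (measurableSet_lt measurable_const hY).nullMeasurableSet)
    (fun a c hac ω (hω : c < Y ω) => hac.trans_lt hω) ⟨0, measure_ne_top _ _⟩
  have he : ⋂ x : ℝ≥0, {ω | x < Y ω} = ∅ := by
    ext ω
    simp only [mem_iInter, mem_ofPred_eq, mem_empty_iff_false, iff_false, not_forall, not_lt]
    exact ⟨Y ω, le_rfl⟩
  rw [he, measure_empty] at h
  have h' := (ENNReal.tendsto_toReal ENNReal.zero_ne_top).comp h
  rw [ENNReal.toReal_zero] at h'
  exact h'

/-- A quantile of the law of `Y`, bounded below by `1`. -/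
def tailQuantile (P : Measure Ω) (Y : Ω → ℝ≥0) (t : ℝ≥0) : ℝ≥0 :=
  max 1 (sInf {x : ℝ≥0 | (t : ℝ) * P.real {ω | x < Y ω} ≤ 1})

omit [IsProbabilityMeasure P] in
theorem tailQuantile_pos (t : ℝ≥0) : 0 < tailQuantile P Y t :=
  one_pos.trans_le (le_max_left _ _)

theorem exists_mul_tail_le (hY : Measurable Y) (t : ℝ≥0) :
    {x : ℝ≥0 | (t : ℝ) * P.real {ω | x < Y ω} ≤ 1}.Nonempty := by
  have h := (tendsto_tail_atTop (P := P) hY).const_mul (t : ℝ)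
  rw [mul_zero] at h
  obtain ⟨x, hx⟩ := (h.eventually (gt_mem_nhds one_pos)).exists
  exact ⟨x, hx.le⟩

theorem monotone_tailQuantile (hY : Measurable Y) : Monotone (tailQuantile P Y) := by
  intro s t hst
  refine max_le_max le_rfl (csInf_le_csInf (OrderBot.bddBelow _) (exists_mul_tail_le hY t) ?_)
  intro x (hx : (t : ℝ) * P.real {ω | x < Y ω} ≤ 1)
  have : (s : ℝ) * P.real {ω | x < Y ω} ≤ t * P.real {ω | x < Y ω} := by gcongr
  exact this.trans hx

theorem mul_tail_le_one (hY : Measurable Y) {t x : ℝ≥0} (hx : tailQuantile P Y t < x) :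
    (t : ℝ) * P.real {ω | x < Y ω} ≤ 1 := by
  obtain ⟨y, hy, hyx⟩ := exists_lt_of_csInf_lt (exists_mul_tail_le hY t)
    ((le_max_right _ _).trans_lt hx)
  have hy' : (t : ℝ) * P.real {ω | y < Y ω} ≤ 1 := hy
  have := antitone_tail (P := P) (Y := Y) hyx.le
  exact (mul_le_mul_of_nonneg_left this t.coe_nonneg).trans hy'

omit [IsProbabilityMeasure P] in
-- A quantile above `1` is not the artificial lower bound, so it equals the infimum and every
-- smaller `x` violates the defining inequality.
theorem one_lt_mul_tail {t x : ℝ≥0} (h1 : 1 < tailQuantile P Y t)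
    (hx : x < tailQuantile P Y t) : 1 < (t : ℝ) * P.real {ω | x < Y ω} := by
  rw [tailQuantile, lt_max_iff] at h1
  rcases h1 with h1 | h1
  · exact absurd h1 (lt_irrefl _)
  · rw [tailQuantile, max_eq_right h1.le] at hx
    by_contra! h
    have hmem : x ∈ {x : ℝ≥0 | (t : ℝ) * P.real {ω | x < Y ω} ≤ 1} := h
    exact absurd (csInf_le (OrderBot.bddBelow _) hmem) (not_le.2 hx)

theorem tendsto_tailQuantile (hY : Measurable Y) (hpos : ∀ x : ℝ≥0, 0 < P.real {ω | x < Y ω}) :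
    Tendsto (tailQuantile P Y) atTop atTop := by
  rw [Filter.tendsto_atTop]
  intro x
  have h2 : Tendsto (fun t : ℝ≥0 => (t : ℝ) * P.real {ω | x < Y ω}) atTop atTop :=
    Tendsto.atTop_mul_const (hpos x) (NNReal.tendsto_coe_atTop.2 tendsto_id)
  filter_upwards [h2.eventually_gt_atTop 1] with t ht
  by_contra! h
  exact absurd (mul_tail_le_one hY h) (not_le.2 ht)

/-- The tail `U` may jump at the quantile `b t`, so it is compared at `b t * c` instead: `t * U (b t
* c)` exceeds `1` for `c < 1` and is at most `1` for `c > 1`. The ratio to `U (b t * z)` converges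
by regular variation, and taking `c` close to `1` closes the gap. -/
theorem isTailScaling_tailQuantile (hY : Measurable Y) (htail : RegularlyVaryingTail P Y α) :
    IsTailScaling P Y α (tailQuantile P Y) := by
  intro z hz
  have hpos := htail.pos
  set b := tailQuantile P Y
  have hb := tendsto_tailQuantile hY hpos
  set U : ℝ≥0 → ℝ := fun x => P.real {ω | x < Y ω}
  have hratio : ∀ c : ℝ≥0, 0 < c →
      Tendsto (fun t => U (b t * z) / U (b t * c)) atTop (𝓝 (((z / c : ℝ≥0) : ℝ) ^ (-α))) := by
    intro c hc
    have h1 := (htail (z / c) (div_pos hz hc)).comp (hb.atTop_mul_const hc)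
    refine h1.congr fun t => ?_
    have : b t * c * (z / c) = b t * z := by field_simp
    change U (b t * c * (z / c)) / U (b t * c) = _
    rw [this]
  have hcont : ContinuousAt (fun c : ℝ≥0 => ((z / c : ℝ≥0) : ℝ) ^ (-α)) 1 := by
    have : ContinuousAt (fun c : ℝ≥0 => ((z / c : ℝ≥0) : ℝ)) 1 := by
      have : ContinuousAt (fun c : ℝ≥0 => z / c) 1 := by
        simp_rw [div_eq_mul_inv]
        exact continuousAt_const.mul (tendsto_inv₀ one_ne_zero)
      exact NNReal.continuous_coe.continuousAt.comp this
    refine this.rpow_const (Or.inl ?_)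
    simpa using hz.ne'
  have hlim : Tendsto (fun c : ℝ≥0 => ((z / c : ℝ≥0) : ℝ) ^ (-α)) (𝓝 1) (𝓝 ((z : ℝ) ^ (-α))) := by
    simpa [ContinuousAt] using hcont
  rw [tendsto_order]
  constructor
  · intro a ha
    have hev : ∀ᶠ c : ℝ≥0 in 𝓝[<] 1, a < ((z / c : ℝ≥0) : ℝ) ^ (-α) ∧ 0 < c :=
      nhdsWithin_le_nhds ((hlim.eventually (lt_mem_nhds ha)).and (lt_mem_nhds one_pos))
    have : (𝓝[<] (1 : ℝ≥0)).NeBot := nhdsLT_neBot_of_exists_lt ⟨0, one_pos⟩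
    obtain ⟨c, ⟨hc1, hc0⟩, hc⟩ := (hev.and self_mem_nhdsWithin).exists
    filter_upwards [(hratio c hc0).eventually (lt_mem_nhds hc1), hb.eventually_gt_atTop 1]
      with t h1 h2
    have h3 : 1 < (t : ℝ) * U (b t * c) :=
      one_lt_mul_tail h2 (mul_lt_of_lt_one_right (one_pos.trans h2) hc)
    have h4 : 0 < U (b t * z) / U (b t * c) := div_pos (hpos _) (hpos _)
    calc a < U (b t * z) / U (b t * c) := h1
      _ ≤ t * U (b t * c) * (U (b t * z) / U (b t * c)) := le_mul_of_one_le_left h4.le h3.le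
      _ = t * U (b t * z) := by
        have : U (b t * c) ≠ 0 := (hpos _).ne'
        field_simp
  · intro a ha
    have hev : ∀ᶠ c : ℝ≥0 in 𝓝[>] 1, ((z / c : ℝ≥0) : ℝ) ^ (-α) < a :=
      nhdsWithin_le_nhds (hlim.eventually (gt_mem_nhds ha))
    obtain ⟨c, hc1, hc⟩ := (hev.and self_mem_nhdsWithin).exists
    have hc : 1 < c := hc
    filter_upwards [(hratio c (one_pos.trans hc)).eventually (gt_mem_nhds hc1),
      hb.eventually_gt_atTop 1] with t h1 h2
    have h3 : (t : ℝ) * U (b t * c) ≤ 1 :=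
      mul_tail_le_one hY (lt_mul_of_one_lt_right (one_pos.trans h2) hc)
    have h4 : 0 < U (b t * z) / U (b t * c) := div_pos (hpos _) (hpos _)
    calc t * U (b t * z) = t * U (b t * c) * (U (b t * z) / U (b t * c)) := by
          have : U (b t * c) ≠ 0 := (hpos _).ne'
          field_simp
      _ ≤ U (b t * z) / U (b t * c) := mul_le_of_le_one_left h4.le h3
      _ < a := h1

end

/-! ### From Lipschitz to continuous test functions -/

namespace RZ

/-- The Lipschitz regularization of a function from below. -/
def infConv (f : RZ → ℝ≥0) (n : ℕ) (x : RZ) : ℝ := ⨅ y, ((f y : ℝ) + n * dZ x y)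

theorem infConv_bddBelow (f : RZ → ℝ≥0) (n : ℕ) (x : RZ) :
    BddBelow (range fun y => (f y : ℝ) + n * dZ x y) :=
  ⟨0, by
    rintro _ ⟨y, rfl⟩
    exact add_nonneg (f y).coe_nonneg (mul_nonneg n.cast_nonneg (dZ_nonneg x y))⟩

theorem infConv_le (f : RZ → ℝ≥0) (n : ℕ) (x : RZ) : infConv f n x ≤ f x := by
  refine (ciInf_le (infConv_bddBelow f n x) x).trans_eq ?_
  rw [dZ_self, mul_zero, add_zero]

theorem infConv_nonneg (f : RZ → ℝ≥0) (n : ℕ) (x : RZ) : 0 ≤ infConv f n x :=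
  le_ciInf fun y => add_nonneg (f y).coe_nonneg (mul_nonneg n.cast_nonneg (dZ_nonneg x y))

theorem infConv_sub_le (f : RZ → ℝ≥0) (n : ℕ) (x x' : RZ) :
    infConv f n x - infConv f n x' ≤ n * dZ x x' := by
  rw [sub_le_comm]
  refine le_ciInf fun y => ?_
  rw [sub_le_iff_le_add]
  refine (ciInf_le (infConv_bddBelow f n x) y).trans ?_
  have h := mul_le_mul_of_nonneg_left (dZ_triangle x x' y) (Nat.cast_nonneg (α := ℝ) n)
  linarith

theorem infConv_mono (f : RZ → ℝ≥0) (x : RZ) : Monotone fun n => infConv f n x := by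
  intro m n hmn
  refine ciInf_mono (infConv_bddBelow f m x) fun y => ?_
  have := dZ_nonneg x y
  gcongr

/-- Near `x` continuity controls `f y`; at distance at least `ε` the penalty `n * dZ x y` exceeds `f
x` once `n * ε ≥ f x`. -/
theorem tendsto_infConv {f : RZ → ℝ≥0} (hf : Continuous f) (x : RZ) :
    Tendsto (fun n => infConv f n x) atTop (𝓝 (f x : ℝ)) := by
  rw [Metric.tendsto_nhds]
  intro e he
  obtain ⟨ε, hε, h⟩ := Metric.continuous_iff.1 hf x (e / 2) (half_pos he)
  obtain ⟨N, hN⟩ := exists_nat_ge ((f x : ℝ) / ε)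
  filter_upwards [eventually_ge_atTop N] with n hn
  have h1 := infConv_le f n x
  have h2 : (f x : ℝ) - e / 2 ≤ infConv f n x := by
    refine le_ciInf fun y => ?_
    rcases lt_or_ge (dZ x y) ε with hy | hy
    · have h3 := h y (by rw [dist_comm]; exact hy)
      rw [NNReal.dist_eq, abs_lt] at h3
      have := mul_nonneg (Nat.cast_nonneg (α := ℝ) n) (dZ_nonneg x y)
      linarith [h3.1]
    · rw [div_le_iff₀ hε] at hN
      have h3 : (N : ℝ) * ε ≤ n * dZ x y := by gcongr
      have := (f y).coe_nonneg
      linarith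
  rw [Real.dist_eq, abs_lt]
  constructor <;> linarith

theorem lipTest_infConv {f : RZ → ℝ≥0} {M : ℝ≥0} {r : ℝ} (hr : 0 < r) (hM : ∀ x, f x ≤ M)
    (h0 : ∀ x, dZ x 0 < r → f x = 0) (n : ℕ) : LipTest (infConv f n) n M r where
  lip_nonneg := n.cast_nonneg
  pos := hr
  lip x y := by
    rw [abs_sub_le_iff]
    exact ⟨infConv_sub_le f n x y, by rw [dZ_comm]; exact infConv_sub_le f n y x⟩
  nonneg := infConv_nonneg f n
  le x := (infConv_le f n x).trans (hM x)
  zero x hx := le_antisymm ((infConv_le f n x).trans (by rw [h0 x hx]; rfl)) (infConv_nonneg f n x)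

/-- A Lipschitz function that is `M` at distance `≥ r` from zero and `0` at distance `< r / 2`. -/
def cutoff (M : ℝ≥0) (r : ℝ) (x : RZ) : ℝ≥0 := M * (min 1 (2 / r * dZ x 0 - 1)).toNNReal

theorem continuous_cutoff (M : ℝ≥0) (r : ℝ) : Continuous (cutoff M r) := by
  have : Continuous fun x : RZ => dZ x 0 := by
    simp_rw [dZ_comm _ 0]; exact continuous_dZ 0
  unfold cutoff
  exact continuous_const.mul (continuous_real_toNNReal.comp (continuous_const.min
    ((continuous_const.mul this).sub continuous_const)))

theorem cutoff_le (M : ℝ≥0) (r : ℝ) (x : RZ) : cutoff M r x ≤ M := by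
  refine mul_le_of_le_one_right zero_le ?_
  rw [Real.toNNReal_le_one]
  exact min_le_left _ _

theorem cutoff_of_le {M : ℝ≥0} {r : ℝ} (hr : 0 < r) {x : RZ} (hx : r ≤ dZ x 0) :
    cutoff M r x = M := by
  have : 1 ≤ 2 / r * dZ x 0 - 1 := by
    have : 2 / r * r ≤ 2 / r * dZ x 0 := by gcongr
    rw [div_mul_cancel₀ _ hr.ne'] at this
    linarith
  rw [cutoff, min_eq_left this, Real.toNNReal_one, mul_one]

theorem cutoff_of_lt {M : ℝ≥0} {r : ℝ} (hr : 0 < r) {x : RZ} (hx : dZ x 0 < r / 2) :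
    cutoff M r x = 0 := by
  have : 2 / r * dZ x 0 - 1 ≤ 0 := by
    have : 2 / r * dZ x 0 ≤ 2 / r * (r / 2) := by gcongr
    have h2 : 2 / r * (r / 2) = 1 := by field_simp
    linarith
  rw [cutoff, Real.toNNReal_of_nonpos ((min_le_right _ _).trans this), mul_zero]

theorem lipTest_cutoff (M : ℝ≥0) {r : ℝ} (hr : 0 < r) :
    LipTest (fun x => (cutoff M r x : ℝ)) (M * (2 / r)) M (r / 2) where
  lip_nonneg := by positivity
  pos := half_pos hr
  lip x y := by
    have h1 : |min 1 (2 / r * dZ x 0 - 1) - min 1 (2 / r * dZ y 0 - 1)| ≤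
        2 / r * |dZ x 0 - dZ y 0| := by
      refine (abs_min_sub_min_le_max _ _ _ _).trans ?_
      rw [sub_self, abs_zero, max_eq_right (abs_nonneg _)]
      rw [show 2 / r * dZ x 0 - 1 - (2 / r * dZ y 0 - 1) = 2 / r * (dZ x 0 - dZ y 0) by ring,
        abs_mul, abs_of_pos (by positivity)]
    have h2 : |dZ x 0 - dZ y 0| ≤ dZ x y := by
      rw [abs_sub_le_iff]
      have h3 := dZ_triangle x y 0
      have h4 := dZ_triangle y x 0
      rw [dZ_comm y x] at h4
      constructor <;> linarith
    have h3 : |max (min 1 (2 / r * dZ x 0 - 1)) 0 - max (min 1 (2 / r * dZ y 0 - 1)) 0| ≤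
        2 / r * dZ x y := by
      refine (abs_max_sub_max_le_abs _ _ _).trans (h1.trans ?_)
      gcongr
    simp only [cutoff, NNReal.coe_mul, Real.coe_toNNReal']
    rw [← mul_sub, abs_mul, abs_of_nonneg M.coe_nonneg, mul_assoc]
    gcongr
  nonneg x := NNReal.coe_nonneg _
  le x := cutoff_le M r x
  zero x hx := by rw [cutoff_of_lt hr hx]; rfl

end RZ

/-- Lower bounds on both summands together with convergence of the sum leave neither summand room to
exceed its limit. Finiteness of `j` permits the cancellation. -/
theorem tendsto_of_add_tendsto {ι : Type*} {l : Filter ι} {I J : ι → ℝ≥0∞} {i j : ℝ≥0∞}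
    (hj : j ≠ ∞) (hsum : Tendsto (fun t => I t + J t) l (𝓝 (i + j)))
    (hI : ∀ a < i, ∀ᶠ t in l, a < I t) (hJ : ∀ a < j, ∀ᶠ t in l, a < J t) :
    Tendsto I l (𝓝 i) := by
  rw [tendsto_order]
  refine ⟨hI, fun a ha => ?_⟩
  rcases eq_or_ne j 0 with rfl | hj0
  · rw [add_zero] at hsum
    filter_upwards [hsum.eventually (gt_mem_nhds ha)] with t ht
    exact le_self_add.trans_lt ht
  · have h1 : i + j < a + j := ENNReal.add_lt_add_right hj ha
    have h2 : Tendsto (fun x => a + x) (𝓝[<] j) (𝓝 (a + j)) :=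
      ((continuous_const.add continuous_id).tendsto j).mono_left nhdsWithin_le_nhds
    have : (𝓝[<] j).NeBot := nhdsLT_neBot_of_exists_lt ⟨0, pos_iff_ne_zero.2 hj0⟩
    obtain ⟨x, hx1, hx2⟩ := ((h2.eventually (lt_mem_nhds h1)).and self_mem_nhdsWithin).exists
    filter_upwards [hsum.eventually (gt_mem_nhds hx1), hJ x hx2] with t h3 h4
    have h5 : I t + J t < a + J t := h3.trans_le (by gcongr)
    exact lt_of_add_lt_add_right h5

/-- Both `f` and `cutoff M r - f` are increasing limits of Lipschitz test functions, which gives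
asymptotic lower bounds for their integrals. Their sum is the cutoff, itself a Lipschitz test
function with finite limit integral, so `tendsto_of_add_tendsto` applies. -/
theorem tendsto_lintegral_of_lipTest {ι : Type*} {l : Filter ι} {μs : ι → Measure RZ}
    {μ : Measure RZ}
    (h : ∀ (F : RZ → ℝ) (L M r : ℝ), LipTest F L M r → ∫⁻ x, ENNReal.ofReal (F x) ∂μ < ∞ ∧
      Tendsto (fun i => ∫⁻ x, ENNReal.ofReal (F x) ∂(μs i)) l
        (𝓝 (∫⁻ x, ENNReal.ofReal (F x) ∂μ)))
    {f : RZ → ℝ≥0} (hf : Continuous f) {M : ℝ≥0} {r : ℝ} (hr : 0 < r) (hM : ∀ x, f x ≤ M)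
    (h0 : ∀ x, dZ x 0 < r → f x = 0) :
    Tendsto (fun i => ∫⁻ x, f x ∂(μs i)) l (𝓝 (∫⁻ x, f x ∂μ)) := by
  have hlow : ∀ (f : RZ → ℝ≥0), Continuous f → ∀ r : ℝ, 0 < r → (∀ x, f x ≤ M) →
      (∀ x, dZ x 0 < r → f x = 0) → ∀ a < ∫⁻ x, f x ∂μ, ∀ᶠ i in l, a < ∫⁻ x, f x ∂(μs i) := by
    intro f hf r hr hM h0 a ha
    have hlim : Tendsto (fun n => ∫⁻ x, ENNReal.ofReal (infConv f n x) ∂μ) atTop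
        (𝓝 (∫⁻ x, f x ∂μ)) := by
      refine lintegral_tendsto_of_tendsto_of_monotone
        (fun n => (lipTest_infConv hr hM h0 n).measurable.ennreal_ofReal.aemeasurable)
        (ae_of_all _ fun x m n hmn => ENNReal.ofReal_le_ofReal (infConv_mono f x hmn))
        (ae_of_all _ fun x => ?_)
      rw [← ENNReal.ofReal_coe_nnreal]
      exact (ENNReal.continuous_ofReal.tendsto _).comp (tendsto_infConv hf x)
    obtain ⟨n, hn⟩ := (hlim.eventually (lt_mem_nhds ha)).exists
    filter_upwards [(h _ _ _ _ (lipTest_infConv hr hM h0 n)).2.eventually (lt_mem_nhds hn)]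
      with i hi
    refine hi.trans_le (lintegral_mono fun x => ?_)
    rw [← ENNReal.ofReal_coe_nnreal]
    exact ENNReal.ofReal_le_ofReal (infConv_le f n x)
  obtain ⟨hGfin, hG⟩ := h _ _ _ _ (lipTest_cutoff M hr)
  simp only [ENNReal.ofReal_coe_nnreal] at hGfin hG
  have hfG : ∀ x, f x ≤ cutoff M r x := by
    intro x
    rcases lt_or_ge (dZ x 0) r with hx | hx
    · rw [h0 x hx]; exact zero_le
    · rw [cutoff_of_le hr hx]; exact hM x
  have hadd : ∀ m : Measure RZ, ∫⁻ x, cutoff M r x ∂m =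
      ∫⁻ x, f x ∂m + ∫⁻ x, (cutoff M r x - f x : ℝ≥0) ∂m := by
    intro m
    rw [← lintegral_add_left hf.measurable.coe_nnreal_ennreal]
    refine lintegral_congr fun x => ?_
    rw [← ENNReal.coe_add, add_tsub_cancel_of_le (hfG x)]
  simp_rw [hadd] at hG
  rw [hadd] at hGfin
  refine tendsto_of_add_tendsto (ENNReal.add_lt_top.1 hGfin).2.ne hG (hlow f hf r hr hM h0)
    (hlow (fun x => cutoff M r x - f x) ((continuous_cutoff M r).sub hf) (r / 2) (half_pos hr)
      (fun x => tsub_le_self.trans (cutoff_le M r x)) fun x hx => ?_)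
  rw [cutoff_of_lt hr hx, zero_tsub]

/-! ### Extension of test functions by zero -/

section Extension

/-- The extension by zero of a test function on `RZ ∖ {0}`. -/
def MOTestFun.extend (f : MOTestFun ({0} : Set RZ)) (x : RZ) : ℝ≥0 :=
  open Classical in if h : x ∈ ({0} : Set RZ)ᶜ then f.toFun ⟨x, h⟩ else 0

variable (f : MOTestFun ({0} : Set RZ))

theorem MOTestFun.extend_coe (x : ↥(({0} : Set RZ)ᶜ)) : f.extend x = f.toFun x :=
  dif_pos x.2

theorem MOTestFun.extend_of_notMem {x : RZ} (h : x ∉ ({0} : Set RZ)ᶜ) : f.extend x = 0 :=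
  dif_neg h

theorem MOTestFun.exists_extend_eq_zero :
    ∃ r : ℝ, 0 < r ∧ ∀ x, dZ x 0 < r → f.extend x = 0 := by
  obtain ⟨r, hr, h⟩ := f.vanishes_near
  refine ⟨r, hr, fun x hx => ?_⟩
  by_cases hx0 : x ∈ ({0} : Set RZ)ᶜ
  · rw [f.extend_coe ⟨x, hx0⟩]
    refine h _ ?_
    rw [Metric.thickening_singleton]
    exact hx
  · exact f.extend_of_notMem hx0

/-- Away from zero the complement is open and continuity is inherited; at zero the extension is
locally constant. -/
theorem MOTestFun.continuous_extend : Continuous f.extend := by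
  rw [continuous_iff_continuousAt]
  intro x
  by_cases hx : x ∈ ({0} : Set RZ)ᶜ
  · have ho : IsOpen ({0} : Set RZ)ᶜ := isClosed_singleton.isOpen_compl
    rw [← ho.isOpenEmbedding_subtypeVal.continuousAt_iff (x := ⟨x, hx⟩)]
    have : f.extend ∘ Subtype.val = f.toFun := funext f.extend_coe
    rw [this]
    exact f.continuous_toFun.continuousAt
  · obtain rfl : x = 0 := by simpa using hx
    obtain ⟨r, hr, h⟩ := f.exists_extend_eq_zero
    refine (continuousAt_const (y := (0 : ℝ≥0))).congr ?_
    filter_upwards [Metric.ball_mem_nhds (0 : RZ) hr] with y hy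
    exact (h y hy).symm

theorem MOTestFun.lintegral_comap (μ : Measure RZ) :
    ∫⁻ x, (f.toFun x : ℝ≥0∞) ∂(μ.comap Subtype.val) = ∫⁻ x, f.extend x ∂μ := by
  have hm : MeasurableSet ({0} : Set RZ)ᶜ := (measurableSet_singleton 0).compl
  simp_rw [← f.extend_coe]
  rw [lintegral_subtype_comap hm fun x => (f.extend x : ℝ≥0∞), setLIntegral_eq_of_support_subset]
  intro x hx
  by_contra h
  exact hx (by simp [f.extend_of_notMem h])

end Extension

/-! ### The limit measure -/

/-- The limit measure, as a measure on the whole sequence space. -/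
def maLimitFull (α : ℝ) (ψ : ℕ → ℝ≥0) : Measure RZ :=
  Measure.sum fun i : ℤ => (nuAlpha α).map fun z => maMap ψ (RZ.single i z)

theorem measurable_maMap_single (ψ : ℕ → ℝ≥0) (i : ℤ) :
    Measurable fun z => maMap ψ (single i z) := by
  refine (measurable_maMap ψ).comp (measurable_iff.2 fun k => ?_)
  by_cases h : k = i
  · rw [h]
    simpa only [single_same] using measurable_id'
  · simpa only [single_of_ne h] using measurable_const

/-- `ν_α` has infinite mass only near zero, where the integrand vanishes. -/
theorem RZ.LipTest.integrable_single {F : RZ → ℝ} {L M r : ℝ} (hF : LipTest F L M r) {α : ℝ}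
    (hα : 0 < α) {ψ : ℕ → ℝ≥0} {B : ℝ≥0} (hB : ∀ j, ψ j ≤ B) (i : ℤ) :
    Integrable (fun z => F (maMap ψ (single i z))) (nuAlpha α) := by
  obtain ⟨η, hη0, hη⟩ := hF.exists_single_eq_zero hB i
  have hfin : nuAlpha α (Ioi η) < ∞ := by rw [nuAlpha_Ioi hα hη0]; exact ENNReal.ofReal_lt_top
  have hon : IntegrableOn (fun z => F (maMap ψ (single i z))) (Ioi η) (nuAlpha α) := by
    refine Measure.integrableOn_of_bounded (M := M) hfin.ne
      (hF.measurable.comp (measurable_maMap_single ψ i)).aestronglyMeasurable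
      (ae_of_all _ fun z => ?_)
    rw [Real.norm_of_nonneg (hF.nonneg _)]
    exact hF.le _
  rw [← integrableOn_iff_integrable_of_support_subset (s := Ioi η)]
  · exact hon
  · intro z hz
    by_contra h
    exact hz (hη z (not_lt.1 h))

theorem RZ.LipTest.lintegral_maLimitFull {F : RZ → ℝ} {L M r : ℝ} (hF : LipTest F L M r) {α : ℝ}
    (hα : 0 < α) {ψ : ℕ → ℝ≥0} {B : ℝ≥0} (hB : ∀ j, ψ j ≤ B)
    (hs : Summable fun i => ∫ z, F (maMap ψ (single i z)) ∂(nuAlpha α)) :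
    ∫⁻ x, ENNReal.ofReal (F x) ∂(maLimitFull α ψ) =
      ENNReal.ofReal (∑' i, ∫ z, F (maMap ψ (single i z)) ∂(nuAlpha α)) := by
  rw [maLimitFull, lintegral_sum_measure,
    ENNReal.ofReal_tsum_of_nonneg (fun i => integral_nonneg fun z => hF.nonneg _) hs]
  refine tsum_congr fun i => ?_
  rw [lintegral_map hF.measurable.ennreal_ofReal (measurable_maMap_single ψ i),
    ofReal_integral_eq_lintegral_ofReal (hF.integrable_single hα hB i)
      (ae_of_all _ fun z => hF.nonneg _)]

/-! ### Convergence of the rescaled laws, finiteness and nontriviality of the limit -/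

section

variable {Ω : Type*} [MeasurableSpace Ω] {P : Measure Ω} [IsProbabilityMeasure P]
  {Z : ℤ → Ω → ℝ≥0} {α δ : ℝ} {ψ : ℕ → ℝ≥0} {b : ℝ≥0 → ℝ≥0}

theorem IsTailScaling.tendsto_lintegral_lipTest (hα : 0 < α) (hmeas : ∀ i, Measurable (Z i))
    (hindep : iIndepFun Z P) (hident : ∀ i, IdentDistrib (Z i) (Z 0) P P)
    (htail : RegularlyVaryingTail P (Z 0) α)
    (hδ : 0 < δ) (hδ1 : δ < min α 1) (hψ : Summable fun j => ψ j ^ δ)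
    {B : ℝ≥0} (hB : ∀ j, ψ j ≤ B) (hb : IsTailScaling P (Z 0) α b)
    (F : RZ → ℝ) (L M r : ℝ) (hF : LipTest F L M r) :
    ∫⁻ x, ENNReal.ofReal (F x) ∂(maLimitFull α ψ) < ∞ ∧
      Tendsto (fun t : ℝ≥0 => ∫⁻ x, ENNReal.ofReal (F x)
        ∂(t • P.map fun ω => (b t)⁻¹ • maMap ψ fun i => Z i ω)) atTop
        (𝓝 (∫⁻ x, ENNReal.ofReal (F x) ∂(maLimitFull α ψ))) := by
  obtain ⟨hs, hlim⟩ := hF.tendsto_tsum hmeas hindep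
    (hb.ae_summable hmeas hident htail hδ hδ1 hψ)
    (hb.uniformTail hmeas hident htail hδ hδ1 hψ)
    (fun i => integral_nonneg fun z => hF.nonneg _)
    (hb.tendsto_integral_scaledMA_singleton hα hmeas hident htail hB hF)
  rw [hF.lintegral_maLimitFull hα hB hs]
  refine ⟨ENNReal.ofReal_lt_top, ?_⟩
  refine ((ENNReal.continuous_ofReal.tendsto _).comp hlim).congr fun t => ?_
  have e : (fun ω => (b t)⁻¹ • maMap ψ fun i => Z i ω) = scaledMA ψ Z (b t) univ := by
    funext ω
    rw [scaledMA, restr_univ]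
    rfl
  rw [e, lintegral_smul_measure, lintegral_map hF.measurable.ennreal_ofReal
    (measurable_scaledMA hmeas _ _), Function.comp_apply, ENNReal.ofReal_mul t.coe_nonneg,
    ofReal_integral_eq_lintegral_ofReal (hF.integrable hmeas _ _)
      (ae_of_all _ fun ω => hF.nonneg _), ENNReal.ofReal_coe_nnreal]
  rfl

end

/-- The cutoff at height `1` dominates the indicator of `{x | r ≤ dZ x 0}` and is a Lipschitz test
function. -/
theorem maLimit_compl_thickening_lt_top {α : ℝ} {ψ : ℕ → ℝ≥0}
    (h : ∀ (F : RZ → ℝ) (L M r : ℝ), LipTest F L M r →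
      ∫⁻ x, ENNReal.ofReal (F x) ∂(maLimitFull α ψ) < ∞) {r : ℝ} (hr : 0 < r) :
    maLimit α ψ {x | (x : RZ) ∉ Metric.thickening r {0}} < ∞ := by
  have h1 := h _ _ _ _ (lipTest_cutoff 1 hr)
  refine lt_of_le_of_lt ?_ h1
  have hm : MeasurableSet {x : RZ | r ≤ dZ x 0} :=
    measurableSet_le measurable_const measurable_dZ_zero
  have hm0 : MeasurableSet ({0} : Set RZ)ᶜ := (measurableSet_singleton 0).compl
  calc maLimit α ψ {x | (x : RZ) ∉ Metric.thickening r {0}}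
      = maLimitFull α ψ (Subtype.val '' {x : ↥(({0} : Set RZ)ᶜ) |
          (x : RZ) ∉ Metric.thickening r {0}}) :=
        (MeasurableEmbedding.subtype_coe hm0).comap_apply _ _
    _ ≤ maLimitFull α ψ {x : RZ | r ≤ dZ x 0} := by
        refine measure_mono ?_
        rintro _ ⟨x, hx, rfl⟩
        rw [mem_ofPred_eq, Metric.thickening_singleton] at hx
        exact not_lt.1 fun h => hx (Metric.mem_ball.2 h)
    _ = ∫⁻ x, {x : RZ | r ≤ dZ x 0}.indicator 1 x ∂(maLimitFull α ψ) :=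
        (lintegral_indicator_one hm).symm
    _ ≤ _ := by
        refine lintegral_mono fun x => ?_
        by_cases hx : r ≤ dZ x 0
        · simp [hx, cutoff_of_le hr hx]
        · simp [hx]

/-- The zeroth coordinate of `T^∞(z e_0)` is `ψ 0 * z > 0`, so the mass `ν_α(1, ∞) = 1` is carried
off zero. -/
theorem maLimit_ne_zero {α : ℝ} (hα : 0 < α) {ψ : ℕ → ℝ≥0} (hψ0 : 0 < ψ 0) :
    maLimit α ψ ≠ 0 := by
  intro h
  have hm0 : MeasurableSet ({0} : Set RZ)ᶜ := (measurableSet_singleton 0).compl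
  have h1 : maLimit α ψ univ = maLimitFull α ψ ({0} : Set RZ)ᶜ := by
    refine ((MeasurableEmbedding.subtype_coe hm0).comap_apply _ _).trans ?_
    rw [image_univ, Subtype.range_coe]
    rfl
  have h2 : nuAlpha α (Ioi 1) ≤ maLimitFull α ψ ({0} : Set RZ)ᶜ := by
    refine le_trans ?_ (Measure.le_sum
      (fun i : ℤ => (nuAlpha α).map fun z => maMap ψ (RZ.single i z)) 0 _)
    rw [Measure.map_apply (measurable_maMap_single ψ 0) hm0]
    refine measure_mono fun z hz h0 => ?_
    have h3 : maMap ψ (single 0 z) 0 = 0 := by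
      rw [show maMap ψ (single 0 z) = 0 from h0]; rfl
    have h4 : maMap ψ (single 0 z) 0 = ψ 0 * z := by
      unfold maMap
      rw [tsum_eq_single 0]
      · rw [Nat.cast_zero, sub_zero, single_same]
      · intro j hj
        rw [single_of_ne (by omega), mul_zero]
    rw [h4] at h3
    exact (mul_pos hψ0 (one_pos.trans hz)).ne' h3
  rw [← h1, h, nuAlpha_Ioi hα one_pos] at h2
  simp at h2

theorem MOMeasure.tendsto_iff {C : Set RZ} {ι : Type*} {l : Filter ι} {μs : ι → MOMeasure C}
    {μ : MOMeasure C} : Tendsto μs l (𝓝 μ) ↔ ∀ f : MOTestFun C,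
      Tendsto (fun i => ∫⁻ x, (f.toFun x : ℝ≥0∞) ∂(μs i).toMeasure) l
        (𝓝 (∫⁻ x, (f.toFun x : ℝ≥0∞) ∂μ.toMeasure)) := by
  rw [nhds_iInf, tendsto_iInf]
  refine forall_congr' fun f => ?_
  rw [nhds_induced, tendsto_comap_iff]
  rfl

end

theorem theorem3p4 {Ω : Type*} [MeasurableSpace Ω] (P : Measure Ω) [IsProbabilityMeasure P]
    (Z : ℤ → Ω → ℝ≥0) (hmeas : ∀ i, Measurable (Z i)) (hindep : iIndepFun Z P)
    (hident : ∀ i, IdentDistrib (Z i) (Z 0) P P)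
    (α : ℝ) (hα : 0 < α) (htail : RegularlyVaryingTail P (Z 0) α)
    (ψ : ℕ → ℝ≥0) (hψ0 : 0 < ψ 0)
    (hψ : ∃ δ : ℝ, 0 < δ ∧ δ < min α 1 ∧ Summable fun j => ψ j ^ δ) :
    -- the series defining the moving average converge almost surely
    (∀ᵐ ω ∂P, ∀ k : ℤ, Summable fun j : ℕ => ψ j * Z (k - j) ω) ∧
    -- the limit measure belongs to `𝕄(RZ ∖ {0})`
    ∃ ν : MOMeasure ({0} : Set RZ), ν.toMeasure = maLimit α ψ ∧
      -- convergence for every scaling function of the innovations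
      (∀ b : ℝ≥0 → ℝ≥0, IsTailScaling P (Z 0) α b →
        Tendsto (fun t : ℝ≥0 => scaledLaw P (fun ω => maMap ψ fun i => Z i ω) t (b t))
          atTop (𝓝 ν)) ∧
      -- hence regular variation of the moving average
      (∃ b : ℝ≥0 → ℝ≥0, IsTailScaling P (Z 0) α b ∧
        RegularlyVarying P (fun ω => maMap ψ fun i => Z i ω) b ν) := by
  obtain ⟨δ, hδ, hδ1, hψδ⟩ := hψ
  -- A single term of the convergent series gives `ψ j ^ δ ≤ ∑ ψ ^ δ`.
  obtain ⟨B, hB⟩ : ∃ B : ℝ≥0, ∀ j, ψ j ≤ B := by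
    refine ⟨(∑' j, ψ j ^ δ) ^ δ⁻¹, fun j => ?_⟩
    have h2 := NNReal.rpow_le_rpow (hψδ.le_tsum j fun _ _ => zero_le) (inv_nonneg.2 hδ.le)
    rwa [← NNReal.rpow_mul, mul_inv_cancel₀ hδ.ne', NNReal.rpow_one] at h2
  have hb₀ := isTailScaling_tailQuantile (hmeas 0) htail
  have hlip := fun (b : ℝ≥0 → ℝ≥0) (hb : IsTailScaling P (Z 0) α b) =>
    hb.tendsto_lintegral_lipTest hα hmeas hindep hident htail hδ hδ1 hψδ hB
  -- Finiteness of the limit comes out of the convergence argument, so one scaling function must be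
  -- at hand; the quantile serves.
  let ν : MOMeasure ({0} : Set RZ) := ⟨maLimit α ψ, fun r hr =>
    maLimit_compl_thickening_lt_top (fun F L M r hF => (hlip _ hb₀ F L M r hF).1) hr⟩
  have hconv : ∀ b : ℝ≥0 → ℝ≥0, IsTailScaling P (Z 0) α b →
      Tendsto (fun t : ℝ≥0 => scaledLaw P (fun ω => maMap ψ fun i => Z i ω) t (b t))
        atTop (𝓝 ν) := by
    intro b hb
    rw [MOMeasure.tendsto_iff]
    intro f
    obtain ⟨r, hr, hfr⟩ := f.exists_extend_eq_zero
    obtain ⟨K, hK⟩ := f.bounded_toFun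
    have hK' : ∀ x, f.extend x ≤ K := by
      intro x
      by_cases hx : x ∈ ({0} : Set RZ)ᶜ
      · rw [f.extend_coe ⟨x, hx⟩]; exact hK _
      · rw [f.extend_of_notMem hx]; exact zero_le
    have h := tendsto_lintegral_of_lipTest (hlip b hb) f.continuous_extend hr hK' hfr
    simp_rw [← f.lintegral_comap] at h
    exact h
  exact ⟨hb₀.ae_summable hmeas hident htail hδ hδ1 hψδ, ν, rfl, hconv, tailQuantile P (Z 0), hb₀,
    ⟨tailQuantile_pos, monotone_tailQuantile (hmeas 0), maLimit_ne_zero hα hψ0, hconv _ hb₀⟩⟩
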